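/- Let $n\ge 0$, $T>0$, $0<\kappa\le 1$, and let $a_{jk}\colon[0,T]\times\mathbb R^n\to\mathbb R$ ($1\le j,k\le n$) be coefficients such that, for all $t\in[0,T]$ and $x,\xi\in\mathbb R^n$: $a_{jk}(t,x)=a_{kj}(t,x)$; $\kappa|\xi|^2\le\sum_{j,k}a_{jk}(t,x)\xi_j\xi_k\le\frac1\kappa|\xi|^2$; there is a constant $C$ with $|a_{jk}(t,x)-a_{jk}(s,x)|\le C|t-s|(1+|\log|t-s||)$ whenever $s,t\in[0,T]$, $0<|t-s|\le1$, $x\in\mathbb R^n$; and the functions $a_{jk}(t,\cdot)$ are bounded and Lipschitz continuous, uniformly in $t\in[0,T]$. All functions are real valued, and $\|u\|_{H^1}^2=\|u\|_{L^2}^2+\|\nabla u\|_{L^2}^2$ on $H^1=H^1(\mathbb R^n)$. For $u,v\in H^1$ set $a(t;u,v)=\int_{\mathbb R^n}\sum_{j,k}a_{jk}(t,x)\,\partial_ju\,\partial_kv\,dx$. For $0\le s\le p\le T$, a solution on $[s,p]$ of $$\partial_tu-\sum_{j,k=1}^n\partial_{x_j}(a_{jk}(t,x)\,\partial_{x_k}u)=0\qquad(*)$$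 is a function $u\in C([s,p];L^2(\mathbb R^n))\cap L^2(s,p;H^1)$ with $\langle u(t),v\rangle_{L^2}+\int_s^ta(\tau;u(\tau),v)\,d\tau=\langle u(s),v\rangle_{L^2}$ for all $v\in H^1$, $t\in[s,p]$. For $f\in L^2$ let $U(p,s)f$ be the value at time $p$ of the solution of $(*)$ on $[s,p]$ with value $f$ at time $s$; $U(p,s)$ is the bounded linear evolution operator of $(*)$ on $L^2(\mathbb R^n)$. Let $M>0$ be any constant with $\|U(T,0)\|_{\mathcal L(L^2,L^2)}\le M$, and for $\alpha>0$ and $u,v\in H^1$ put $$b_\alpha(u,v)=\alpha\bigl(a(0;u,v)+\langle u,v\rangle_{L^2}\bigr)+\langle U(T,0)u,U(T,0)v\rangle_{L^2}.$$ Let $\bar u\colon[0,T]\to H^1$ be a solution of $(*)$ on $[0,T]$ with $\|\bar u(0)\|_{H^1}\le E$, let $\delta>0$, let $g\in L^2(\mathbb R^n)$ satisfy $\|g-\bar u(T)\|_{L^2}\le\delta$, and put $\alpha=\delta M\kappa$. Then the problem of finding $w\in H^1$ with $b_\alpha(w,h)=\phi(h)$ for all $h\in H^1$ is well posed: for every $\phi\in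 H^{-1}=(H^1)^*$ it has exactly one solution $w\in H^1$, and $\|w\|_{H^1}\le\frac1{\kappa\alpha}\|\phi\|_{H^{-1}}$. In particular there is a unique $u_{g,\delta}\in H^1$ with $$b_\alpha(u_{g,\delta},h)=\langle U(T,0)^*g,h\rangle_{L^2}\quad\text{for all }h\in H^1.$$ The function $u(t):=U(t,0)u_{g,\delta}$ is a solution of $(*)$ on $[0,T]$ with $u(0)=u_{g,\delta}$, and $$\|u(0)-\bar u(0)\|_{H^1}\le\frac1{\kappa^2}(1+E),\qquad \|u(T)-\bar u(T)\|_{L^2}\le\frac{M^{1/2}}{\kappa}(1+E)\,\delta^{1/2}.$$ -/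

import Mathlib

open MeasureTheory Set
open scoped ContDiff InnerProductSpace

noncomputable section

namespace ParabolicQBV

/-- Euclidean space `ℝⁿ`. -/
abbrev Rn (n : ℕ) : Type := EuclideanSpace ℝ (Fin n)

/-- The real Hilbert space `L²(ℝⁿ)`. -/
abbrev L2 (n : ℕ) : Type := Lp ℝ 2 (volume : Measure (Rn n))

/-- `g` is the weak partial derivative `∂f/∂x_j`. -/
def HasWeakPartial {n : ℕ} (j : Fin n) (f g : L2 n) : Prop :=
  ∀ φ : Rn n → ℝ, ContDiff ℝ ∞ φ → HasCompactSupport φ →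
    ∫ x, f x * fderiv ℝ φ x (EuclideanSpace.single j 1) = -∫ x, g x * φ x

theorem integrable_mul_test {n : ℕ} (f : L2 n) {ψ : Rn n → ℝ} (hψ : Continuous ψ)
    (hc : HasCompactSupport ψ) : Integrable (fun x => f x * ψ x) :=
  (Lp.memLp f).integrable_mul (q := 2) (hψ.memLp_of_hasCompactSupport hc)

theorem integrable_mul_partial {n : ℕ} (f : L2 n) (j : Fin n) {φ : Rn n → ℝ}
    (hφ : ContDiff ℝ ∞ φ) (hc : HasCompactSupport φ) :
    Integrable (fun x => f x * fderiv ℝ φ x (EuclideanSpace.single j 1)) :=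
  integrable_mul_test f
    ((hφ.continuous_fderiv (by simp)).clm_apply continuous_const)
    (hc.fderiv_apply (𝕜 := ℝ) _)

theorem HasWeakPartial.zero {n : ℕ} (j : Fin n) : HasWeakPartial j (0 : L2 n) 0 := by
  intro φ _ _
  have h : ((0 : L2 n) : Rn n → ℝ) =ᵐ[volume] 0 := Lp.coeFn_zero ℝ 2 volume
  rw [integral_eq_zero_of_ae, integral_eq_zero_of_ae, neg_zero]
  · filter_upwards [h] with x hx
    simp only [hx, Pi.zero_apply, zero_mul]
  · filter_upwards [h] with x hx
    simp only [hx, Pi.zero_apply, zero_mul]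

theorem HasWeakPartial.add {n : ℕ} {j : Fin n} {f g f' g' : L2 n}
    (h : HasWeakPartial j f g) (h' : HasWeakPartial j f' g') :
    HasWeakPartial j (f + f') (g + g') := by
  intro φ hφ hc
  have e1 : ∫ x, (f + f') x * fderiv ℝ φ x (EuclideanSpace.single j 1) =
      ∫ x, (f x * fderiv ℝ φ x (EuclideanSpace.single j 1)
        + f' x * fderiv ℝ φ x (EuclideanSpace.single j 1)) := by
    refine integral_congr_ae ?_
    filter_upwards [Lp.coeFn_add f f'] with x hx
    simp only [hx, Pi.add_apply, add_mul]
  have e2 : ∫ x, (g + g') x * φ x = ∫ x, (g x * φ x + g' x * φ x) := by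
    refine integral_congr_ae ?_
    filter_upwards [Lp.coeFn_add g g'] with x hx
    simp only [hx, Pi.add_apply, add_mul]
  rw [e1, e2, integral_add (integrable_mul_partial f j hφ hc) (integrable_mul_partial f' j hφ hc),
    integral_add (integrable_mul_test g hφ.continuous hc)
      (integrable_mul_test g' hφ.continuous hc), h φ hφ hc, h' φ hφ hc]
  ring

theorem HasWeakPartial.smul {n : ℕ} {j : Fin n} {f g : L2 n} (c : ℝ)
    (h : HasWeakPartial j f g) : HasWeakPartial j (c • f) (c • g) := by
  intro φ hφ hc
  have e1 : ∫ x, (c • f) x * fderiv ℝ φ x (EuclideanSpace.single j 1) =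
      ∫ x, c * (f x * fderiv ℝ φ x (EuclideanSpace.single j 1)) := by
    refine integral_congr_ae ?_
    filter_upwards [Lp.coeFn_smul c f] with x hx
    simp only [hx, Pi.smul_apply, smul_eq_mul, mul_assoc]
  have e2 : ∫ x, (c • g) x * φ x = ∫ x, c * (g x * φ x) := by
    refine integral_congr_ae ?_
    filter_upwards [Lp.coeFn_smul c g] with x hx
    simp only [hx, Pi.smul_apply, smul_eq_mul, mul_assoc]
  rw [e1, e2, integral_const_mul, integral_const_mul, h φ hφ hc]
  ring

/-- The Sobolev space `H¹(ℝⁿ)`: pairs `(f, ∇f)` with `f ∈ L²` and weak gradient `∇f ∈ (L²)ⁿ`.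
The inherited inner product is `⟨u, v⟩_{L²} + ∑ⱼ ⟨∂ⱼu, ∂ⱼv⟩_{L²}`. -/
def sobolevH1 (n : ℕ) : Submodule ℝ (WithLp 2 (L2 n × PiLp 2 (fun _ : Fin n => L2 n))) where
  carrier := {p | ∀ j, HasWeakPartial j p.fst (p.snd j)}
  zero_mem' := fun j => HasWeakPartial.zero j
  add_mem' := fun hp hq j => (hp j).add (hq j)
  smul_mem' := fun c _ hp j => (hp j).smul c

/-- The real inner product space `H¹(ℝⁿ)`. -/
abbrev H1 (n : ℕ) : Type := sobolevH1 n

/-- The `L²` function underlying an element of `H¹`. -/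
def H1.fn {n : ℕ} (u : H1 n) : L2 n := u.1.fst

/-- The weak partial derivative `∂ⱼu` of an element of `H¹`. -/
def H1.partialDeriv {n : ℕ} (u : H1 n) (j : Fin n) : L2 n := u.1.snd j

/-- The standing hypotheses on the coefficients `a_{jk}(t,x)`, `t ∈ [0,T]`, `x ∈ ℝⁿ`:
symmetry, uniform ellipticity with constant `κ ∈ (0,1]`, Log-Lipschitz continuity in `t`
uniformly in `x`, boundedness and Lipschitz continuity in `x` uniformly in `t`. -/
structure IsAdmissible {n : ℕ} (a : ℝ → Rn n → Matrix (Fin n) (Fin n) ℝ) (T κ : ℝ) : Prop where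
  kappa_pos : 0 < κ
  kappa_le_one : κ ≤ 1
  symm : ∀ t ∈ Icc 0 T, ∀ x j k, a t x j k = a t x k j
  elliptic : ∀ t ∈ Icc 0 T, ∀ x, ∀ ξ : Rn n,
    κ * ‖ξ‖ ^ 2 ≤ ∑ j, ∑ k, a t x j k * ξ j * ξ k ∧
      ∑ j, ∑ k, a t x j k * ξ j * ξ k ≤ 1 / κ * ‖ξ‖ ^ 2
  logLip : ∃ C : ℝ, ∀ t ∈ Icc 0 T, ∀ s ∈ Icc 0 T, 0 < |t - s| → |t - s| ≤ 1 → ∀ x j k,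
    |a t x j k - a s x j k| ≤ C * (|t - s| * (1 + |Real.log (|t - s|)|))
  lip : ∃ C : ℝ, ∀ t ∈ Icc 0 T, ∀ j k,
    (∀ x, |a t x j k| ≤ C) ∧ ∀ x y, |a t x j k - a t y j k| ≤ C * ‖x - y‖

/-- The bilinear form `a(t;u,v) = ∫ ∑ⱼₖ aⱼₖ(t,x) ∂ⱼu(x) ∂ₖv(x) dx` on `H¹`. -/
def aForm {n : ℕ} (a : ℝ → Rn n → Matrix (Fin n) (Fin n) ℝ) (t : ℝ) (u v : H1 n) : ℝ :=
  ∫ x, ∑ j, ∑ k, a t x j k * u.partialDeriv j x * v.partialDeriv k x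

/-- `u` is a (weak) solution of `∂ₜu - ∑ⱼₖ ∂ⱼ(aⱼₖ ∂ₖu) = 0` on `[s,p] × ℝⁿ`:
`u ∈ C([s,p]; L²) ∩ L²(s,p; H¹)` and, for every `v ∈ H¹` and `t ∈ [s,p]`,
`⟨u(t),v⟩ + ∫ₛᵗ a(τ;u(τ),v) dτ = ⟨u(s),v⟩`. The function `w` is the representative of `u`
as an element of `L²(s,p; H¹)`. -/
def IsSolution {n : ℕ} (a : ℝ → Rn n → Matrix (Fin n) (Fin n) ℝ) (s p : ℝ)
    (u : ℝ → L2 n) : Prop :=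
  ContinuousOn u (Icc s p) ∧
    ∃ w : ℝ → H1 n, MemLp w 2 (volume.restrict (Icc s p)) ∧
      (∀ᵐ t ∂(volume.restrict (Icc s p)), (w t).fn = u t) ∧
      ∀ v : H1 n, ∀ t ∈ Icc s p,
        ⟪u t, v.fn⟫_ℝ + ∫ τ in s..t, aForm a τ (w τ) v = ⟪u s, v.fn⟫_ℝ

/-- `S` sends every `f ∈ L²` to the value at time `p` of a solution on `[s,p]` that equals `f`
at time `s`. -/
def IsSolutionOperator {n : ℕ} (a : ℝ → Rn n → Matrix (Fin n) (Fin n) ℝ) (p s : ℝ)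
    (S : L2 n →L[ℝ] L2 n) : Prop :=
  ∀ f : L2 n, ∃ u : ℝ → L2 n, IsSolution a s p u ∧ u s = f ∧ u p = S f

open Classical in
/-- The evolution operator `U(p,s)` on `L²`: the bounded linear operator sending `f` to the
value at time `p` of the solution with value `f` at time `s`. -/
def evol {n : ℕ} (a : ℝ → Rn n → Matrix (Fin n) (Fin n) ℝ) (p s : ℝ) : L2 n →L[ℝ] L2 n :=
  if h : ∃ S, IsSolutionOperator a p s S then h.choose else 0

/-- The bilinear form
`b_α(u,v) = α (a(0;u,v) + ⟨u,v⟩_{L²}) + ⟨U(T,0)u, U(T,0)v⟩_{L²}` on `H¹`. -/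
def bForm {n : ℕ} (a : ℝ → Rn n → Matrix (Fin n) (Fin n) ℝ) (T α : ℝ) (u v : H1 n) : ℝ :=
  α * (aForm a 0 u v + ⟪u.fn, v.fn⟫_ℝ) + ⟪evol a T 0 u.fn, evol a T 0 v.fn⟫_ℝ

end ParabolicQBV

end

namespace ParabolicQBV

open Filter Topology

/-! ### Products of primitives of Bochner integrable functions. -/

section ProductRule

variable {E F G : Type*} [NormedAddCommGroup E] [NormedSpace ℝ E]
  [NormedAddCommGroup F] [NormedSpace ℝ F] [NormedAddCommGroup G] [NormedSpace ℝ G]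

/-! The stability estimate is a Tikhonov argument. Let `Q` represent `a(0;u,v) + ⟨u,v⟩` on `H¹`, let
`A` be `U(T,0)` restricted to `H¹`, and let `d` be the difference of the regularized and the true
initial value. Testing the variational equation with `d` gives `α⟨Qd,d⟩ + ‖Ad‖² = ⟨g - A ū(0), Ad⟩ -
α⟨Q ū(0), d⟩`. With `α = δMκ` both terms on the right are of size `δM‖d‖`, so the right-hand side is
at most `δM(1+E)‖d‖`, while the left is at least `ακ‖d‖² + ‖Ad‖²`. Keeping the first term bounds
`‖d‖`; keeping the second then bounds `‖Ad‖`. This is `regularization_estimate`; well-posedness is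
Lax–Milgram (`regularized_wellPosed`).

Most of the work goes into showing that `U(T,0)` really is the solution operator, that is, into
existence and uniqueness for the forward problem. This is done for an abstract pair `i : V → H`,
with the dual of `V` replaced by `V` itself through Riesz: the equation becomes an identity in `V`
for `i^* u`.

Uniqueness rests on `energy_identity`, the analogue of the Lions–Magenes lemma. A weak solution `w`
is only square integrable in `V`, but `i^* i w` is a primitive, and the product rule applies after
inserting the resolvent of `i^* i`, which is then removed by a limit.

Existence uses no Galerkin scheme. An a priori bound for `C¹` functions
(`IsParabolic.exists_apriori`) controls `w` by its initial value and source. The pairs (initial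
value, source) of `C¹` functions are dense in `H × L²(0,T;V)` (`IsParabolic.dense_data`), because a
pair orthogonal to all of them solves a homogeneous backward problem and vanishes by the same energy
identity. Approximating `(u₀, 0)` by such pairs gives the solution as a limit. -/

theorem intervalIntegrable_bilin_left (L : E →L[ℝ] F →L[ℝ] G) {f : ℝ → E} {g : ℝ → F} {s t : ℝ}
    (hf : IntervalIntegrable f volume s t) (hg : ContinuousOn g (uIcc s t)) :
    IntervalIntegrable (fun τ => L (f τ) (g τ)) volume s t := by
  rw [intervalIntegrable_iff] at hf ⊢
  obtain ⟨C, hC⟩ := isCompact_uIcc.exists_bound_of_continuousOn hg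
  have hgm : AEStronglyMeasurable g (volume.restrict (uIoc s t)) :=
    (hg.mono uIoc_subset_uIcc).aestronglyMeasurable measurableSet_uIoc
  refine Integrable.mono' (hf.norm.const_mul (‖L‖ * C))
    (L.aestronglyMeasurable_comp₂ hf.aestronglyMeasurable hgm) ?_
  filter_upwards [ae_restrict_mem measurableSet_uIoc] with τ hτ
  calc ‖L (f τ) (g τ)‖ ≤ ‖L‖ * ‖f τ‖ * ‖g τ‖ := L.le_opNorm₂ _ _
    _ ≤ ‖L‖ * ‖f τ‖ * C := by gcongr; exact hC τ (uIoc_subset_uIcc hτ)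
    _ = ‖L‖ * C * ‖f τ‖ := by ring

variable [CompleteSpace E] [CompleteSpace F] [CompleteSpace G]

/-- Product rule, in integrated form, for primitives of integrable functions vanishing at the left
end point. -/
theorem bilin_integral_integral (L : E →L[ℝ] F →L[ℝ] G) {f : ℝ → E} {g : ℝ → F} {s t : ℝ}
    (hst : s ≤ t) (hf : IntervalIntegrable f volume s t) (hg : IntervalIntegrable g volume s t) :
    L (∫ τ in s..t, f τ) (∫ τ in s..t, g τ) =
      (∫ τ in s..t, L (f τ) (∫ σ in s..τ, g σ)) + ∫ τ in s..t, L (∫ σ in s..τ, f σ) (g τ) := by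
  rw [intervalIntegrable_iff_integrableOn_Ioc_of_le hst] at hf hg
  set μ := volume.restrict (Ioc s t) with hμ
  have hint : Integrable (fun p : ℝ × ℝ => L (f p.1) (g p.2)) (μ.prod μ) :=
    Integrable.op_fst_snd (op := fun x y => L x y) (by fun_prop)
      ⟨‖L‖, fun x y => L.le_opNorm₂ x y⟩ hf hg
  -- Fubini: the square splits along its diagonal, and each integral on the right is the integral
  -- over one of the two triangles.
  set A : Set (ℝ × ℝ) := {p | p.2 ≤ p.1} with hA
  have hAm : MeasurableSet A := measurableSet_le measurable_snd measurable_fst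
  have h1 : (∫ τ in s..t, L (f τ) (∫ σ in s..τ, g σ)) =
      ∫ p in A, L (f p.1) (g p.2) ∂(μ.prod μ) := by
    rw [← integral_indicator hAm, integral_prod _ (hint.indicator hAm),
      intervalIntegral.integral_of_le hst]
    refine setIntegral_congr_fun measurableSet_Ioc fun τ hτ => ?_
    have e : (fun σ => A.indicator (fun p : ℝ × ℝ => L (f p.1) (g p.2)) (τ, σ)) =
        (Iic τ).indicator fun σ => L (f τ) (g σ) := by
      ext σ; simp [A, indicator]
    have e2 : Ioc s t ∩ Iic τ = Ioc s τ := by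
      ext σ; simp only [mem_inter_iff, mem_Ioc, mem_Iic] at hτ ⊢
      exact ⟨fun h => ⟨h.1.1, h.2⟩, fun h => ⟨⟨h.1, h.2.trans hτ.2⟩, h.2⟩⟩
    rw [e, integral_indicator measurableSet_Iic, hμ, Measure.restrict_restrict measurableSet_Iic,
      inter_comm, e2, intervalIntegral.integral_of_le hτ.1.le,
      ContinuousLinearMap.integral_comp_comm]
    exact IntegrableOn.mono_set hg (Ioc_subset_Ioc_right hτ.2)
  have h2 : (∫ τ in s..t, L (∫ σ in s..τ, f σ) (g τ)) =
      ∫ p in Aᶜ, L (f p.1) (g p.2) ∂(μ.prod μ) := by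
    rw [← integral_indicator hAm.compl, integral_prod _ (hint.indicator hAm.compl),
      integral_integral_swap (f := fun x y => Aᶜ.indicator
        (fun p : ℝ × ℝ => L (f p.1) (g p.2)) (x, y)) (hint.indicator hAm.compl),
      intervalIntegral.integral_of_le hst]
    refine setIntegral_congr_fun measurableSet_Ioc fun τ hτ => ?_
    have e : (fun σ => Aᶜ.indicator (fun p : ℝ × ℝ => L (f p.1) (g p.2)) (σ, τ)) =
        (Iio τ).indicator fun σ => L.flip (g τ) (f σ) := by
      ext σ; simp [A, indicator]
    have e2 : Ioc s t ∩ Iio τ = Ioo s τ := by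
      ext σ; simp only [mem_inter_iff, mem_Ioc, mem_Iio, mem_Ioo] at hτ ⊢
      exact ⟨fun h => ⟨h.1.1, h.2⟩, fun h => ⟨⟨h.1, h.2.le.trans hτ.2⟩, h.2⟩⟩
    rw [e, integral_indicator measurableSet_Iio, hμ, Measure.restrict_restrict measurableSet_Iio,
      inter_comm, e2, ← integral_Ioc_eq_integral_Ioo, intervalIntegral.integral_of_le hτ.1.le,
      ContinuousLinearMap.integral_comp_comm]
    · rfl
    · exact IntegrableOn.mono_set hf (Ioc_subset_Ioc_right hτ.2)
  rw [h1, h2, integral_add_compl hAm hint, integral_prod _ hint,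
    intervalIntegral.integral_of_le hst, intervalIntegral.integral_of_le hst]
  have : ∀ x, ∫ y, L (f x) (g y) ∂μ = L.flip (∫ y, g y ∂μ) (f x) := fun x => by
    rw [ContinuousLinearMap.integral_comp_comm _ hg]; rfl
  simp only [this]
  rw [ContinuousLinearMap.integral_comp_comm _ hf]; rfl

/-- Product rule, in integrated form, for primitives of integrable functions. -/
theorem bilin_primitive (L : E →L[ℝ] F →L[ℝ] G) {f : ℝ → E} {g : ℝ → F} {s t : ℝ}
    (hst : s ≤ t) (hf : IntervalIntegrable f volume s t) (hg : IntervalIntegrable g volume s t)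
    (x : E) (y : F) :
    L (x + ∫ τ in s..t, f τ) (y + ∫ τ in s..t, g τ) = L x y +
      ((∫ τ in s..t, L (f τ) (y + ∫ σ in s..τ, g σ)) +
        ∫ τ in s..t, L (x + ∫ σ in s..τ, f σ) (g τ)) := by
  have h1 : (∫ τ in s..t, L (f τ) (y + ∫ σ in s..τ, g σ)) =
      L (∫ τ in s..t, f τ) y + ∫ τ in s..t, L (f τ) (∫ σ in s..τ, g σ) := by
    simp only [map_add]
    rw [intervalIntegral.integral_add]
    · congr 1
      exact (L.flip y).intervalIntegral_comp_comm hf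
    · exact intervalIntegrable_bilin_left L hf continuousOn_const
    · exact intervalIntegrable_bilin_left L hf
        (intervalIntegral.continuousOn_primitive_interval' hg left_mem_uIcc)
  have h2 : (∫ τ in s..t, L (x + ∫ σ in s..τ, f σ) (g τ)) =
      L x (∫ τ in s..t, g τ) + ∫ τ in s..t, L (∫ σ in s..τ, f σ) (g τ) := by
    simp only [map_add, _root_.add_apply]
    rw [intervalIntegral.integral_add]
    · congr 1
      exact (L x).intervalIntegral_comp_comm hg
    · exact intervalIntegrable_bilin_left L.flip hg continuousOn_const
    · exact intervalIntegrable_bilin_left L.flip hg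
        (intervalIntegral.continuousOn_primitive_interval' hf left_mem_uIcc)
  rw [h1, h2]
  simp only [map_add, _root_.add_apply, bilin_integral_integral L hst hf hg]
  abel

end ProductRule

/-! ### Coercive operators, resolvent regularization and the energy identity. -/

section Coercive

variable {V : Type*} [NormedAddCommGroup V] [InnerProductSpace ℝ V] [CompleteSpace V]

/-- **Lax–Milgram** for a coercive bounded operator. -/
theorem exists_equiv_of_coercive (S : V →L[ℝ] V) {c : ℝ} (hc : 0 < c)
    (h : ∀ v, c * ‖v‖ ^ 2 ≤ ⟪S v, v⟫_ℝ) : ∃ e : V ≃L[ℝ] V, ∀ v, e v = S v := by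
  let b : V →L[ℝ] V →L[ℝ] ℝ := (innerSL ℝ).comp S
  have hb : IsCoercive b := ⟨c, hc, fun u => by
    have := h u
    simp only [b, ContinuousLinearMap.comp_apply, innerSL_apply_apply]
    nlinarith⟩
  refine ⟨hb.continuousLinearEquivOfBilin, fun v => ?_⟩
  refine ext_inner_right ℝ fun w => ?_
  rw [hb.continuousLinearEquivOfBilin_apply]
  simp [b]

/-- The resolvents `(K + ε)⁻¹` of a nonnegative symmetric operator with trivial kernel. -/
theorem exists_regularization (K : V →L[ℝ] V) (hsymm : ∀ u v, ⟪K u, v⟫_ℝ = ⟪u, K v⟫_ℝ)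
    (hpos : ∀ v, 0 ≤ ⟪K v, v⟫_ℝ) (hinj : ∀ v, K v = 0 → v = 0) :
    ∃ P : ℕ → V →L[ℝ] V, (∀ m u v, ⟪P m u, v⟫_ℝ = ⟪u, P m v⟫_ℝ) ∧
      (∀ m v, ‖P m (K v)‖ ≤ 2 * ‖v‖) ∧ ∀ v, Tendsto (fun m => P m (K v)) atTop (𝓝 v) := by
  have hε : ∀ m : ℕ, (0 : ℝ) < 1 / (m + 1) := fun m => Nat.one_div_pos_of_nat
  have hex : ∀ m : ℕ, ∃ e : V ≃L[ℝ] V, ∀ v, e v = K v + (1 / (m + 1) : ℝ) • v := fun m => by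
    refine (exists_equiv_of_coercive (K + (1 / (m + 1) : ℝ) • ContinuousLinearMap.id ℝ V)
      (hε m) fun v => ?_).imp fun e he v => by simpa using he v
    simp only [_root_.add_apply, _root_.smul_apply,
      ContinuousLinearMap.id_apply, inner_add_left, inner_smul_left, real_inner_self_eq_norm_sq]
    have := hpos v
    simp only [conj_trivial]
    linarith
  choose e he using hex
  set P : ℕ → V →L[ℝ] V := fun m => ((e m).symm : V →L[ℝ] V) with hP
  have heP : ∀ m v, K (P m v) + (1 / (m + 1) : ℝ) • P m v = v := fun m v => by
    rw [← he m]; simp [P]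
  -- With `ε = 1/(m+1)`, convergence of `P m (K v)` to `v` is the statement `ε P m v → 0`. The
  -- operators `ε P m` are contractions, so a dense set of `v` suffices; on the range of `K` the
  -- quantity is `O(ε)`.
  have hPK : ∀ m v, P m (K v) = v - (1 / (m + 1) : ℝ) • P m v := fun m v => by
    have : K v = e m v - (1 / (m + 1) : ℝ) • v := by rw [he]; abel
    rw [this, map_sub, map_smul]
    simp [P]
  have hr : ∀ (m : ℕ) v, ‖(1 / (m + 1) : ℝ) • P m v‖ ≤ ‖v‖ := fun m v => by
    have h1 := congrArg (fun x => ⟪x, P m v⟫_ℝ) (heP m v)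
    simp only [inner_add_left, inner_smul_left, real_inner_self_eq_norm_sq, conj_trivial] at h1
    have h2 := real_inner_le_norm v (P m v)
    have h3 := hpos (P m v)
    rw [norm_smul, Real.norm_of_nonneg (hε m).le]
    rcases (norm_nonneg (P m v)).eq_or_lt with h0 | h0
    · rw [← h0]; simp
    · refine le_of_mul_le_mul_right ?_ h0
      nlinarith
  have hb : ∀ m v, ‖P m (K v)‖ ≤ 2 * ‖v‖ := fun m v => by
    rw [hPK]
    linarith [norm_sub_le v ((1 / (m + 1) : ℝ) • P m v), hr m v]
  refine ⟨P, fun m u v => ?_, hb, fun v => ?_⟩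
  · have hu := heP m u
    have hv := heP m v
    calc ⟪P m u, v⟫_ℝ = ⟪P m u, K (P m v) + (1 / (m + 1) : ℝ) • P m v⟫_ℝ := by rw [hv]
      _ = ⟪K (P m u) + (1 / (m + 1) : ℝ) • P m u, P m v⟫_ℝ := by
        simp only [inner_add_left, inner_add_right, inner_smul_left, inner_smul_right, hsymm,
          conj_trivial]
      _ = ⟪u, P m v⟫_ℝ := by rw [hu]
  -- The orthogonal complement of the range of a symmetric operator is its kernel, here trivial.
  · have hdense : Dense (K.range : Set V) := by
      rw [Submodule.dense_iff_topologicalClosure_eq_top, Submodule.topologicalClosure_eq_top_iff,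
        Submodule.eq_bot_iff]
      intro x hx
      refine hinj x (ext_inner_right ℝ fun y => ?_)
      rw [hsymm, inner_zero_left, real_inner_comm]
      exact (Submodule.mem_orthogonal _ _).1 hx _ ⟨y, rfl⟩
    rw [Metric.tendsto_atTop]
    intro η hη
    obtain ⟨_, ⟨y, rfl⟩, hy⟩ := Metric.mem_closure_iff.1 (hdense v) (η / 2) (by positivity)
    obtain ⟨N, hN⟩ := exists_nat_one_div_lt (show (0 : ℝ) < η / 2 / (2 * ‖y‖ + 1) by positivity)
    refine ⟨N, fun m hm => ?_⟩
    have hm' : (1 / (m + 1) : ℝ) * (2 * ‖y‖) < η / 2 := by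
      have h1 : (1 / (m + 1) : ℝ) ≤ 1 / (N + 1) := Nat.one_div_le_one_div hm
      have h2 := h1.trans_lt hN
      rw [lt_div_iff₀ (by positivity)] at h2
      nlinarith [hε m, norm_nonneg y]
    rw [dist_eq_norm, hPK]
    have e1 : v - (1 / (m + 1) : ℝ) • P m v - v =
        -((1 / (m + 1) : ℝ) • P m (v - K y) + (1 / (m + 1) : ℝ) • P m (K y)) := by
      rw [map_sub, smul_sub]; abel
    rw [e1, norm_neg]
    change dist v (K y) < _ at hy
    rw [dist_eq_norm] at hy
    calc _ ≤ ‖(1 / (m + 1) : ℝ) • P m (v - K y)‖ + ‖(1 / (m + 1) : ℝ) • P m (K y)‖ :=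
          norm_add_le _ _
      _ ≤ ‖v - K y‖ + (1 / (m + 1) : ℝ) * (2 * ‖y‖) := by
          rw [norm_smul _ (P m (K y)), Real.norm_of_nonneg (hε m).le]
          gcongr
          · exact hr _ _
          · exact hb _ _
      _ < η := by linarith

/-- Energy identity: if `K w` is a primitive of `F`, then `⟨K w, w⟩' = 2 ⟨w, F⟩` in integrated
form. -/
theorem energy_identity (K : V →L[ℝ] V) (hsymm : ∀ u v, ⟪K u, v⟫_ℝ = ⟪u, K v⟫_ℝ)
    (hpos : ∀ v, 0 ≤ ⟪K v, v⟫_ℝ) (hinj : ∀ v, K v = 0 → v = 0) {s t : ℝ} (hst : s ≤ t)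
    {w F : ℝ → V} (hw : MemLp w 2 (volume.restrict (Ioc s t)))
    (hF : MemLp F 2 (volume.restrict (Ioc s t))) {x y : V}
    (hKw : ∀ᵐ τ ∂volume.restrict (Ioc s t), K (w τ) = K x + ∫ σ in s..τ, F σ)
    (hKy : K y = K x + ∫ σ in s..t, F σ) :
    ⟪K y, y⟫_ℝ = ⟪K x, x⟫_ℝ + 2 * ∫ τ in s..t, ⟪w τ, F τ⟫_ℝ := by
  obtain ⟨P, hPs, hPb, hPt⟩ := exists_regularization K hsymm hpos hinj
  have hFi : IntervalIntegrable F volume s t :=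
    (intervalIntegrable_iff_integrableOn_Ioc_of_le hst).2 (hF.integrable one_le_two)
  -- The regularized energy `⟪P m (K w), K w⟫` involves only the primitive `K w`, so the product
  -- rule applies although `w` itself has no derivative. The bound `2‖v‖` on `P m (K v)` provides
  -- the dominating function when `m → ∞`.
  have key : ∀ m, ⟪P m (K y), K y⟫_ℝ = ⟪P m (K x), K x⟫_ℝ +
      2 * ∫ τ in s..t, ⟪P m (K (w τ)), F τ⟫_ℝ := fun m => by
    have h := bilin_primitive ((innerSL ℝ).comp (P m)) hst hFi hFi (K x) (K x)
    simp only [← hKy, ContinuousLinearMap.comp_apply, innerSL_apply_apply] at h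
    rw [h, two_mul]
    congr 2
    · rw [intervalIntegral.integral_of_le hst, intervalIntegral.integral_of_le hst]
      refine integral_congr_ae ?_
      filter_upwards [hKw] with τ hτ
      rw [hτ, hPs, real_inner_comm]
    · rw [intervalIntegral.integral_of_le hst, intervalIntegral.integral_of_le hst]
      refine integral_congr_ae ?_
      filter_upwards [hKw] with τ hτ
      rw [hτ]
  have l1 : Tendsto (fun m => ⟪P m (K y), K y⟫_ℝ) atTop (𝓝 ⟪y, K y⟫_ℝ) :=
    (hPt y).inner tendsto_const_nhds
  have l2 : Tendsto (fun m => ⟪P m (K x), K x⟫_ℝ) atTop (𝓝 ⟪x, K x⟫_ℝ) :=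
    (hPt x).inner tendsto_const_nhds
  have l3 : Tendsto (fun m => ∫ τ in s..t, ⟪P m (K (w τ)), F τ⟫_ℝ) atTop
      (𝓝 (∫ τ in s..t, ⟪w τ, F τ⟫_ℝ)) := by
    simp only [intervalIntegral.integral_of_le hst]
    refine tendsto_integral_of_dominated_convergence (fun τ => 2 * (‖w τ‖ * ‖F τ‖)) (fun m => ?_)
      ?_ (fun m => ?_) ?_
    · exact ((P m).continuous.comp_aestronglyMeasurable
        (K.continuous.comp_aestronglyMeasurable hw.1)).inner hF.1
    · exact (hw.norm.integrable_mul (q := 2) hF.norm).const_mul 2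
    · refine Eventually.of_forall fun τ => (norm_inner_le_norm _ _).trans ?_
      rw [← mul_assoc]
      gcongr
      exact hPb _ _
    · exact Eventually.of_forall fun τ => (hPt _).inner tendsto_const_nhds
  rw [hsymm, hsymm]
  refine tendsto_nhds_unique l1 ?_
  simp only [key]
  exact l2.add (l3.const_mul 2)

end Coercive

/-! ### The abstract parabolic problem: uniqueness and the a priori estimate. -/

section Abstract

variable {V H : Type*} [NormedAddCommGroup V] [InnerProductSpace ℝ V] [CompleteSpace V]
  [NormedAddCommGroup H] [InnerProductSpace ℝ H] [CompleteSpace H]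

/-- Data of an abstract parabolic problem: an injective embedding `i : V → H` with dense range and
a continuous family of nonnegative operators `B t` on `V`, coercive relative to `H`. -/
structure IsParabolic (i : V →L[ℝ] H) (B : ℝ → V →L[ℝ] V) (T : ℝ) : Prop where
  inj : ∀ v, i v = 0 → v = 0
  dense : ∀ h : H, (∀ v, ⟪i v, h⟫_ℝ = 0) → h = 0
  cont : ContinuousOn B (Icc 0 T)
  nonneg : ∀ t ∈ Icc 0 T, ∀ v, 0 ≤ ⟪B t v, v⟫_ℝ
  coercive : ∃ κ : ℝ, 0 < κ ∧ ∀ t ∈ Icc 0 T, ∀ v, κ * ‖v‖ ^ 2 ≤ ⟪B t v, v⟫_ℝ + κ * ‖i v‖ ^ 2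

/-- `u` solves `u' + B u = 0` on `[0,T]` in the weak sense, with `V`-valued representative `w`. -/
structure IsWeakSol (i : V →L[ℝ] H) (B : ℝ → V →L[ℝ] V) (T : ℝ) (u : ℝ → H) (w : ℝ → V) :
    Prop where
  cont : ContinuousOn u (Icc 0 T)
  memLp : MemLp w 2 (volume.restrict (Icc 0 T))
  ae_eq : ∀ᵐ t ∂volume.restrict (Icc 0 T), i (w t) = u t
  eqn : ∀ t ∈ Icc 0 T, ContinuousLinearMap.adjoint i (u t) + ∫ τ in 0..t, B τ (w τ) =
    ContinuousLinearMap.adjoint i (u 0)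

/-- The operator `i^* i` on `V`. -/
noncomputable def gram (i : V →L[ℝ] H) : V →L[ℝ] V := (ContinuousLinearMap.adjoint i).comp i

theorem gram_apply (i : V →L[ℝ] H) (v : V) :
    gram i v = ContinuousLinearMap.adjoint i (i v) := rfl

theorem inner_gram (i : V →L[ℝ] H) (u v : V) : ⟪gram i u, v⟫_ℝ = ⟪i u, i v⟫_ℝ := by
  rw [gram_apply, ContinuousLinearMap.adjoint_inner_left]

theorem inner_gram_self (i : V →L[ℝ] H) (v : V) : ⟪gram i v, v⟫_ℝ = ‖i v‖ ^ 2 := by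
  rw [inner_gram, real_inner_self_eq_norm_sq]

theorem gram_symm (i : V →L[ℝ] H) (u v : V) : ⟪gram i u, v⟫_ℝ = ⟪u, gram i v⟫_ℝ := by
  rw [inner_gram, real_inner_comm, ← inner_gram, real_inner_comm]

theorem gram_nonneg (i : V →L[ℝ] H) (v : V) : 0 ≤ ⟪gram i v, v⟫_ℝ := by
  rw [inner_gram_self]; positivity

theorem eq_zero_of_gram {i : V →L[ℝ] H} (hi : ∀ v, i v = 0 → v = 0) (v : V) (h : gram i v = 0) :
    v = 0 := by
  have := inner_gram_self i v
  rw [h, inner_zero_left] at this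
  exact hi v (by simpa using this.symm)

theorem memLp_clm_apply {V : Type*} [NormedAddCommGroup V] [NormedSpace ℝ V] {B : ℝ → V →L[ℝ] V} {T : ℝ} (hB : ContinuousOn B (Icc 0 T)) {w : ℝ → V}
    (hw : MemLp w 2 (volume.restrict (Icc 0 T))) :
    MemLp (fun t => B t (w t)) 2 (volume.restrict (Icc 0 T)) := by
  obtain ⟨C, hC⟩ := isCompact_Icc.exists_bound_of_continuousOn hB
  refine hw.of_le_mul (c := C) ?_ ?_
  · exact (ContinuousLinearMap.apply ℝ V).flip.aestronglyMeasurable_comp₂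
      (hB.aestronglyMeasurable measurableSet_Icc) hw.1
  · filter_upwards [ae_restrict_mem measurableSet_Icc] with t ht
    exact (B t).le_of_opNorm_le (hC t ht) _

theorem intervalIntegrable_of_memLp {E : Type*} [NormedAddCommGroup E] {T : ℝ} {w : ℝ → E}
    (hw : MemLp w 2 (volume.restrict (Icc 0 T))) {s t : ℝ} (hs : s ∈ Icc 0 T) (ht : t ∈ Icc 0 T) :
    IntervalIntegrable w volume s t := by
  rw [intervalIntegrable_iff]
  exact IntegrableOn.mono_set (hw.integrable one_le_two)
    (uIoc_subset_uIcc.trans (uIcc_subset_Icc hs ht))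

theorem memLp_of_continuousOn {E : Type*} [NormedAddCommGroup E] {T : ℝ} {w : ℝ → E}
    (hw : ContinuousOn w (Icc 0 T)) : MemLp w 2 (volume.restrict (Icc 0 T)) := by
  obtain ⟨C, hC⟩ := isCompact_Icc.exists_bound_of_continuousOn hw
  refine MemLp.of_bound (hw.aestronglyMeasurable measurableSet_Icc) C ?_
  filter_upwards [ae_restrict_mem measurableSet_Icc] with t ht using hC t ht

/-- Uniqueness of weak solutions. -/
theorem IsWeakSol.eq_zero {i : V →L[ℝ] H} {B : ℝ → V →L[ℝ] V} {T : ℝ} (hp : IsParabolic i B T)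
    {u : ℝ → H} {w : ℝ → V} (hu : IsWeakSol i B T u w) (h0 : u 0 = 0) :
    ∀ t ∈ Icc 0 T, u t = 0 := by
  intro t ht
  -- For `T = 0` the interval is a null set and almost everywhere statements say nothing, so this
  -- case is separate.
  rcases (ht.1.trans ht.2).eq_or_lt with hT | hT
  · have : t = 0 := le_antisymm (by rw [hT]; exact ht.2) ht.1
    rw [this, h0]
  have hBw := memLp_clm_apply hp.cont hu.memLp
  have hae : u =ᵐ[volume.restrict (Icc 0 T)] fun _ => 0 := by
    filter_upwards [hu.ae_eq, ae_restrict_mem measurableSet_Icc] with t hit ht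
    have hsub : Ioc 0 t ⊆ Icc 0 T := fun τ hτ => ⟨hτ.1.le, hτ.2.trans ht.2⟩
    have hμ := Measure.restrict_mono hsub (le_refl (volume : Measure ℝ))
    have key : ∀ τ ∈ Icc 0 T, i (w τ) = u τ →
        gram i (w τ) = gram i 0 + ∫ σ in 0..τ, -(B σ (w σ)) := fun τ hτ hiτ => by
      have h := hu.eqn τ hτ
      rw [h0, map_zero] at h
      rw [gram_apply, hiτ, intervalIntegral.integral_neg, map_zero, zero_add]
      exact eq_neg_of_add_eq_zero_left h
    -- The energy balance `‖u t‖² = -2 ∫ ⟪w, B w⟫` holds at those `t` where `w` represents `u`;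
    -- continuity of `u` later covers the remaining times.
    have h := energy_identity (gram i) (gram_symm i) (gram_nonneg i) (eq_zero_of_gram hp.inj) ht.1
      (hu.memLp.mono_measure hμ) (F := fun τ => -(B τ (w τ))) (hBw.neg.mono_measure hμ) (x := 0)
      (y := w t) (by
        filter_upwards [ae_mono hμ hu.ae_eq, ae_restrict_mem measurableSet_Ioc] with τ hτ hτ'
        exact key τ (hsub hτ') hτ) (key t ht hit)
    have h1 : 0 ≤ ∫ τ in 0..t, ⟪w τ, B τ (w τ)⟫_ℝ :=
      intervalIntegral.integral_nonneg ht.1 fun τ hτ => by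
        rw [real_inner_comm]; exact hp.nonneg τ ⟨hτ.1, hτ.2.trans ht.2⟩ _
    simp only [inner_gram_self, inner_neg_right, intervalIntegral.integral_neg, map_zero,
      inner_zero_left, hit] at h
    have h2 : ‖u t‖ ^ 2 ≤ 0 := by linarith
    simpa using h2
  exact Measure.eqOn_Icc_of_ae_eq volume hT.ne hae hu.cont continuousOn_const ht

/-- Energy estimate for continuously differentiable functions. -/
theorem IsParabolic.exists_apriori {i : V →L[ℝ] H} {B : ℝ → V →L[ℝ] V} {T : ℝ} (hT : 0 ≤ T)
    (hp : IsParabolic i B T) : ∃ C : ℝ, 0 ≤ C ∧ ∀ w : ℝ → V, ContDiff ℝ 1 w →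
      (∀ t ∈ Icc 0 T, ‖i (w t)‖ ^ 2 ≤ C * (‖i (w 0)‖ ^ 2 +
        ∫ τ in 0..T, ‖gram i (deriv w τ) + B τ (w τ)‖ ^ 2)) ∧
      ∫ τ in 0..T, ‖w τ‖ ^ 2 ≤ C * (‖i (w 0)‖ ^ 2 +
        ∫ τ in 0..T, ‖gram i (deriv w τ) + B τ (w τ)‖ ^ 2) := by
  obtain ⟨κ, hκ, hco⟩ := hp.coercive
  -- Coercivity together with the energy balance gives `2κW ≤ q (I + F/η + ηW)`. The Young parameter
  -- `η = κ/q` makes `qηW = κW`, so half of the left side absorbs that term.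
  set q := 1 + 2 * κ * T with hq
  have hq1 : 1 ≤ q := by have := mul_nonneg hκ.le hT; linarith
  set η := κ / q with hη
  have hη0 : 0 < η := by positivity
  set A := q / κ + (q / κ) ^ 2 with hA
  have hA0 : 0 ≤ A := by positivity
  refine ⟨(1 + 1 / η + η * A) + A, by positivity, fun w hw => ?_⟩
  have hwc : Continuous w := hw.continuous
  have hw' : Continuous (deriv w) := hw.continuous_deriv le_rfl
  have hd : ∀ t, HasDerivAt w (deriv w t) t := fun t =>
    (hw.differentiable (by simp) t).hasDerivAt
  have hBw : ContinuousOn (fun τ => B τ (w τ)) (Icc 0 T) := hp.cont.clm_apply hwc.continuousOn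
  set f : ℝ → V := fun τ => gram i (deriv w τ) + B τ (w τ) with hf
  have hfc : ContinuousOn f (Icc 0 T) :=
    ((gram i).continuous.comp hw').continuousOn.add hBw
  set I := ‖i (w 0)‖ ^ 2
  set F := ∫ τ in 0..T, ‖f τ‖ ^ 2 with hF
  set W := ∫ τ in 0..T, ‖w τ‖ ^ 2 with hW
  have hI0 : 0 ≤ I := by positivity
  have hF0 : 0 ≤ F := intervalIntegral.integral_nonneg hT fun τ _ => by positivity
  have hW0 : 0 ≤ W := intervalIntegral.integral_nonneg hT fun τ _ => by positivity
  have ii : ∀ {g : ℝ → ℝ}, ContinuousOn g (Icc 0 T) → ∀ {t}, t ∈ Icc 0 T →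
      IntervalIntegrable g volume 0 t := fun {g} hg {t} ht =>
    (hg.mono (by rw [uIcc_of_le ht.1]; exact Icc_subset_Icc_right ht.2)).intervalIntegrable
  have cBww : ContinuousOn (fun τ => ⟪B τ (w τ), w τ⟫_ℝ) (Icc 0 T) :=
    hBw.inner hwc.continuousOn
  have cfw : ContinuousOn (fun τ => ⟪f τ, w τ⟫_ℝ) (Icc 0 T) := hfc.inner hwc.continuousOn
  have hTm : T ∈ Icc 0 T := ⟨hT, le_rfl⟩
  have energy : ∀ t ∈ Icc 0 T, ‖i (w t)‖ ^ 2 = I +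
      (2 * ∫ τ in 0..t, ⟪f τ, w τ⟫_ℝ) - 2 * ∫ τ in 0..t, ⟪B τ (w τ), w τ⟫_ℝ := by
    intro t ht
    have hder : ∀ τ ∈ uIcc 0 t, HasDerivAt (fun τ => ‖i (w τ)‖ ^ 2)
        (2 * ⟪f τ, w τ⟫_ℝ - 2 * ⟪B τ (w τ), w τ⟫_ℝ) τ := by
      intro τ _
      have h1 : HasDerivAt (fun τ => i (w τ)) (i (deriv w τ)) τ :=
        i.hasFDerivAt.comp_hasDerivAt τ (hd τ)
      convert h1.norm_sq using 1
      simp only [f, inner_add_left, inner_gram]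
      rw [real_inner_comm]; ring
    have := intervalIntegral.integral_eq_sub_of_hasDerivAt hder
      (((ii cfw ht).const_mul 2).sub ((ii cBww ht).const_mul 2))
    rw [intervalIntegral.integral_sub ((ii cfw ht).const_mul 2) ((ii cBww ht).const_mul 2),
      intervalIntegral.integral_const_mul, intervalIntegral.integral_const_mul] at this
    simp only [I]; linarith
  have young : ∀ t ∈ Icc 0 T, 2 * ∫ τ in 0..t, ⟪f τ, w τ⟫_ℝ ≤ 1 / η * F + η * W := by
    intro t ht
    have cf2 : ContinuousOn (fun τ => ‖f τ‖ ^ 2) (Icc 0 T) := hfc.norm.pow 2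
    have cw2 : ContinuousOn (fun τ => ‖w τ‖ ^ 2) (Icc 0 T) := (hwc.norm.pow 2).continuousOn
    have csum : ContinuousOn (fun τ => 1 / η * ‖f τ‖ ^ 2 + η * ‖w τ‖ ^ 2) (Icc 0 T) :=
      (cf2.const_mul _).add (cw2.const_mul _)
    have h1 : ∀ τ, 2 * ⟪f τ, w τ⟫_ℝ ≤ 1 / η * ‖f τ‖ ^ 2 + η * ‖w τ‖ ^ 2 := fun τ => by
      have h2 := real_inner_le_norm (f τ) (w τ)
      have h3 : 0 ≤ 1 / η * (‖f τ‖ - η * ‖w τ‖) ^ 2 := by positivity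
      have h4 : 1 / η * (‖f τ‖ - η * ‖w τ‖) ^ 2 =
        1 / η * ‖f τ‖ ^ 2 + η * ‖w τ‖ ^ 2 - 2 * (‖f τ‖ * ‖w τ‖) := by field_simp; ring
      linarith
    calc 2 * ∫ τ in 0..t, ⟪f τ, w τ⟫_ℝ = ∫ τ in 0..t, 2 * ⟪f τ, w τ⟫_ℝ :=
          (intervalIntegral.integral_const_mul _ _).symm
      _ ≤ ∫ τ in 0..t, (1 / η * ‖f τ‖ ^ 2 + η * ‖w τ‖ ^ 2) :=
          intervalIntegral.integral_mono_on ht.1 ((ii cfw ht).const_mul 2) (ii csum ht)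
            fun τ _ => h1 τ
      _ ≤ ∫ τ in 0..T, (1 / η * ‖f τ‖ ^ 2 + η * ‖w τ‖ ^ 2) :=
          intervalIntegral.integral_mono_interval le_rfl ht.1 ht.2
            (Eventually.of_forall fun τ => by positivity) (ii csum hTm)
      _ = 1 / η * F + η * W := by
          rw [intervalIntegral.integral_add ((ii cf2 hTm).const_mul _) ((ii cw2 hTm).const_mul _),
            intervalIntegral.integral_const_mul, intervalIntegral.integral_const_mul]
  have hm : ∀ t ∈ Icc 0 T, ‖i (w t)‖ ^ 2 ≤ I + 1 / η * F + η * W := fun t ht => by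
    have h1 : 0 ≤ ∫ τ in 0..t, ⟪B τ (w τ), w τ⟫_ℝ :=
      intervalIntegral.integral_nonneg ht.1 fun τ hτ => hp.nonneg τ ⟨hτ.1, hτ.2.trans ht.2⟩ _
    linarith [energy t ht, young t ht]
  have hWle : W ≤ A * (I + F) := by
    have ci : ContinuousOn (fun τ => ‖i (w τ)‖ ^ 2) (Icc 0 T) :=
      ((i.continuous.comp hwc).norm.pow 2).continuousOn
    have h1 : κ * W ≤ (∫ τ in 0..T, ⟪B τ (w τ), w τ⟫_ℝ) + κ * (T * (I + 1 / η * F + η * W)) := by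
      calc κ * W = ∫ τ in 0..T, κ * ‖w τ‖ ^ 2 := (intervalIntegral.integral_const_mul _ _).symm
        _ ≤ ∫ τ in 0..T, (⟪B τ (w τ), w τ⟫_ℝ + κ * ‖i (w τ)‖ ^ 2) :=
            intervalIntegral.integral_mono_on hT
              (ii ((hwc.norm.pow 2).const_mul κ).continuousOn hTm)
              (ii (cBww.add (ci.const_mul κ)) hTm) fun τ hτ => hco τ hτ _
        _ = (∫ τ in 0..T, ⟪B τ (w τ), w τ⟫_ℝ) + κ * ∫ τ in 0..T, ‖i (w τ)‖ ^ 2 := by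
            rw [intervalIntegral.integral_add (ii cBww hTm) ((ii ci hTm).const_mul κ),
              intervalIntegral.integral_const_mul]
        _ ≤ _ := by
            gcongr
            calc ∫ τ in 0..T, ‖i (w τ)‖ ^ 2 ≤ ∫ _ in 0..T, (I + 1 / η * F + η * W) :=
                intervalIntegral.integral_mono_on hT (ii ci hTm) (by simp) hm
              _ = _ := by simp; ring
    have h2 := energy T hTm
    have h3 := young T hTm
    have h4 : 0 ≤ ‖i (w T)‖ ^ 2 := by positivity
    have h5 : 2 * (κ * W) ≤ q * (I + 1 / η * F + η * W) := by rw [hq]; linarith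
    have h6 : q * (η * W) = κ * W := by rw [hη]; field_simp
    have h7 : W ≤ q / κ * I + (q / κ) ^ 2 * F := by
      have e : q / κ * I + (q / κ) ^ 2 * F = q * (I + 1 / η * F) / κ := by
        rw [hη]; field_simp
      rw [e, le_div_iff₀ hκ]
      linarith
    have h8 : 0 ≤ (q / κ) ^ 2 * I := by positivity
    have h9 : 0 ≤ q / κ * F := by positivity
    rw [hA]; linarith
  have hIF : 0 ≤ I + F := by positivity
  refine ⟨fun t ht => (hm t ht).trans ?_, hWle.trans ?_⟩
  · have h1 : η * W ≤ η * (A * (I + F)) := by gcongr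
    have h2 : 0 ≤ 1 / η * I := by positivity
    have h3 : 0 ≤ A * (I + F) := by positivity
    linarith
  · have : 0 ≤ (1 + 1 / η + η * A) * (I + F) := by positivity
    linarith

end Abstract

/-! ### Existence of weak solutions by density of the data of `C¹` functions. -/

section Existence

variable {V H : Type*} [NormedAddCommGroup V] [InnerProductSpace ℝ V] [CompleteSpace V]
  [NormedAddCommGroup H] [InnerProductSpace ℝ H] [CompleteSpace H]

/-- The Hilbert space of pairs of an initial value in `H` and a source term in `L²(0,T;V)`. -/
abbrev DataSpace (V H : Type*) [NormedAddCommGroup V] [InnerProductSpace ℝ V]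
    [NormedAddCommGroup H] [InnerProductSpace ℝ H] (T : ℝ) : Type _ :=
  WithLp 2 (H × Lp V 2 (volume.restrict (Icc 0 T) : Measure ℝ))

/-- `p` consists of the initial value and the source term of the `C¹` function `w`. -/
structure IsData (i : V →L[ℝ] H) (B : ℝ → V →L[ℝ] V) (T : ℝ) (p : DataSpace V H T)
    (w : ℝ → V) : Prop where
  contDiff : ContDiff ℝ 1 w
  fst : p.fst = i (w 0)
  snd : p.snd =ᵐ[volume.restrict (Icc 0 T)] fun t => gram i (deriv w t) + B t (w t)

variable {i : V →L[ℝ] H} {B : ℝ → V →L[ℝ] V} {T : ℝ}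

theorem IsData.add {p q : DataSpace V H T} {w z : ℝ → V} (hp : IsData i B T p w)
    (hq : IsData i B T q z) : IsData i B T (p + q) (w + z) where
  contDiff := hp.contDiff.add hq.contDiff
  fst := by simp [hp.fst, hq.fst]
  snd := by
    filter_upwards [hp.snd, hq.snd, Lp.coeFn_add p.snd q.snd] with t h1 h2 h3
    rw [WithLp.add_snd, h3, Pi.add_apply, h1, h2,
      deriv_add (hp.contDiff.differentiable (by simp) t) (hq.contDiff.differentiable (by simp) t)]
    simp only [map_add, Pi.add_apply]
    abel

theorem IsData.smul {p : DataSpace V H T} {w : ℝ → V} (c : ℝ) (hp : IsData i B T p w) :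
    IsData i B T (c • p) (c • w) where
  contDiff := hp.contDiff.const_smul c
  fst := by simp [hp.fst]
  snd := by
    filter_upwards [hp.snd, Lp.coeFn_smul c p.snd] with t h1 h3
    rw [WithLp.smul_snd, h3, Pi.smul_apply, h1,
      deriv_const_smul c (hp.contDiff.differentiable (by simp) t)]
    simp only [map_smul, Pi.smul_apply, smul_add]

theorem IsData.sub {p q : DataSpace V H T} {w z : ℝ → V} (hp : IsData i B T p w)
    (hq : IsData i B T q z) : IsData i B T (p - q) (w - z) := by
  simpa [sub_eq_add_neg] using hp.add (hq.smul (-1))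

theorem exists_isData (hB : ContinuousOn B (Icc 0 T)) {w : ℝ → V} (hw : ContDiff ℝ 1 w) :
    ∃ p : DataSpace V H T, IsData i B T p w := by
  have hc : ContinuousOn (fun t => gram i (deriv w t) + B t (w t)) (Icc 0 T) :=
    ((gram i).continuous.comp (hw.continuous_deriv le_rfl)).continuousOn.add
      (hB.clm_apply hw.continuous.continuousOn)
  exact ⟨WithLp.toLp 2 (i (w 0), (memLp_of_continuousOn hc).toLp _), hw, rfl,
    (memLp_of_continuousOn hc).coeFn_toLp⟩

theorem norm_sq_eq_integral {α E : Type*} [MeasurableSpace α] {μ : Measure α}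
    [NormedAddCommGroup E] [InnerProductSpace ℝ E] (f : Lp E 2 μ) :
    ‖f‖ ^ 2 = ∫ x, ‖f x‖ ^ 2 ∂μ := by
  rw [← real_inner_self_eq_norm_sq, L2.inner_def]
  simp only [real_inner_self_eq_norm_sq]

theorem IsData.norm_sq {p : DataSpace V H T} (hT : 0 ≤ T) {w : ℝ → V} (hp : IsData i B T p w) :
    ‖p‖ ^ 2 = ‖i (w 0)‖ ^ 2 + ∫ τ in 0..T, ‖gram i (deriv w τ) + B τ (w τ)‖ ^ 2 := by
  rw [WithLp.prod_norm_sq_eq_of_L2, hp.fst, norm_sq_eq_integral,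
    intervalIntegral.integral_of_le hT, ← integral_Icc_eq_integral_Ioc]
  congr 1
  refine integral_congr_ae ?_
  filter_upwards [hp.snd] with t ht
  rw [ht]

/-- If `g` is orthogonal to all source terms of smooth functions, it solves a backward problem. -/
theorem backward_equation (hT : 0 ≤ T) (hB : ContinuousOn B (Icc 0 T)) {h₀ : H} {g : ℝ → V}
    (hg : MemLp g 2 (volume.restrict (Icc 0 T)))
    (horth : ∀ w : ℝ → V, ContDiff ℝ 1 w → ⟪i (w 0), h₀⟫_ℝ +
      ∫ t in 0..T, ⟪gram i (deriv w t) + B t (w t), g t⟫_ℝ = 0) :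
    ContinuousLinearMap.adjoint i h₀ +
        ∫ τ in 0..T, ContinuousLinearMap.adjoint (B τ) (g τ) = 0 ∧
      ∀ᵐ t ∂volume.restrict (Icc 0 T), gram i (g t) +
        ∫ τ in t..T, ContinuousLinearMap.adjoint (B τ) (g τ) = 0 := by
  set A : ℝ → V →L[ℝ] V := fun t => ContinuousLinearMap.adjoint (B t) with hA
  have hAc : ContinuousOn A (Icc 0 T) :=
    (ContinuousLinearMap.adjoint (𝕜 := ℝ) (E := V) (F := V)).continuous.comp_continuousOn hB
  have hAg : MemLp (fun t => A t (g t)) 2 (volume.restrict (Icc 0 T)) := memLp_clm_apply hAc hg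
  have hKg : MemLp (fun t => gram i (g t)) 2 (volume.restrict (Icc 0 T)) :=
    memLp_clm_apply (B := fun _ => gram i) continuousOn_const hg
  have h0m : (0 : ℝ) ∈ Icc 0 T := ⟨le_rfl, hT⟩
  have hTm : T ∈ Icc 0 T := ⟨hT, le_rfl⟩
  have iA : ∀ {s t}, s ∈ Icc 0 T → t ∈ Icc 0 T →
      IntervalIntegrable (fun t => A t (g t)) volume s t := intervalIntegrable_of_memLp hAg
  have iK : IntervalIntegrable (fun t => gram i (g t)) volume 0 T :=
    intervalIntegrable_of_memLp hKg h0m hTm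
  let L : ℝ →L[ℝ] V →L[ℝ] V := ContinuousLinearMap.lsmul ℝ ℝ
  have hL : ∀ c v, L c v = c • v := fun c v => rfl
  have ism : ∀ {φ : ℝ → ℝ} {f : ℝ → V}, Continuous φ → IntervalIntegrable f volume 0 T →
      IntervalIntegrable (fun t => φ t • f t) volume 0 T := fun {φ f} hφ hf =>
    intervalIntegrable_bilin_left L.flip hf hφ.continuousOn
  -- Testing with separated functions `Φ(t) v` and letting `v` vary turns the scalar orthogonality
  -- relation into an identity in `V`.
  have weak : ∀ Φ : ℝ → ℝ, ContDiff ℝ 1 Φ → Φ 0 • ContinuousLinearMap.adjoint i h₀ +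
      ((∫ t in 0..T, deriv Φ t • gram i (g t)) + ∫ t in 0..T, Φ t • A t (g t)) = 0 := by
    intro Φ hΦ
    have j1 := ism (hΦ.continuous_deriv le_rfl) iK
    have j2 := ism hΦ.continuous (iA h0m hTm)
    rw [← intervalIntegral.integral_add j1 j2]
    refine ext_inner_left ℝ fun v => ?_
    have h := horth (fun t => Φ t • v) (hΦ.smul contDiff_const)
    rw [inner_add_right, inner_smul_right, ContinuousLinearMap.adjoint_inner_right,
      inner_zero_right, intervalIntegral.integral_of_le hT,
      ← integral_inner (𝕜 := ℝ) ((intervalIntegrable_iff_integrableOn_Ioc_of_le hT).1 (j1.add j2)),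
      ← intervalIntegral.integral_of_le hT]
    refine Eq.trans ?_ h
    rw [map_smul, inner_smul_left, conj_trivial]
    congr 1
    refine intervalIntegral.integral_congr fun t _ => ?_
    have hd : deriv (fun t => Φ t • v) t = deriv Φ t • v :=
      deriv_smul_const (hΦ.differentiable (by simp) t) v
    simp only [hd, map_smul, inner_add_left, inner_add_right, inner_smul_left, inner_smul_right,
      conj_trivial, A, ContinuousLinearMap.adjoint_inner_right, gram_symm]
  have h1 : ContinuousLinearMap.adjoint i h₀ + ∫ τ in 0..T, A τ (g τ) = 0 := by
    simpa using weak (fun _ => 1) contDiff_const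
  refine ⟨h1, ?_⟩
  have hsplit : ∀ t ∈ Icc 0 T, ∫ τ in t..T, A τ (g τ) =
      (∫ τ in 0..T, A τ (g τ)) - ∫ τ in 0..t, A τ (g τ) := fun t ht => by
    rw [← intervalIntegral.integral_add_adjacent_intervals (iA h0m ht) (iA ht hTm)]; abel
  set r : ℝ → V := fun t => gram i (g t) +
    ((∫ τ in 0..T, A τ (g τ)) - ∫ τ in 0..t, A τ (g τ)) with hr
  have cG : ContinuousOn (fun t => ∫ τ in 0..t, A τ (g τ)) (Icc 0 T) := by
    have := intervalIntegral.continuousOn_primitive_interval' (iA h0m hTm) left_mem_uIcc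
    rwa [uIcc_of_le hT] at this
  have iG : IntervalIntegrable (fun t => ∫ τ in 0..t, A τ (g τ)) volume 0 T :=
    intervalIntegrable_of_memLp (memLp_of_continuousOn cG) h0m hTm
  have ir : IntegrableOn r (Icc 0 T) := by
    rw [integrableOn_Icc_iff_integrableOn_Ioc, ← intervalIntegrable_iff_integrableOn_Ioc_of_le hT]
    exact iK.add ((intervalIntegrable_const).sub iG)
  have hzero : ∀ᵐ t, (Icc 0 T).indicator r t = 0 := by
    refine ae_eq_zero_of_integral_contDiff_smul_eq_zero
      (ir.integrable_indicator measurableSet_Icc).locallyIntegrable fun φ hφ _ => ?_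
    have e1 : ∀ t, φ t • (Icc 0 T).indicator r t = (Icc 0 T).indicator (fun t => φ t • r t) t :=
      fun t => by by_cases ht : t ∈ Icc 0 T <;> simp [ht]
    simp only [e1]
    rw [integral_indicator measurableSet_Icc, integral_Icc_eq_integral_Ioc,
      ← intervalIntegral.integral_of_le hT]
    -- Du Bois-Reymond argument: the primitive vanishes at `0`, which removes the initial term, and
    -- integrating `∫ Φ A g` by parts leaves `∫ φ r = 0`. As `φ` is an arbitrary test function, `r`
    -- vanishes almost everywhere.
    set Φ : ℝ → ℝ := fun t => ∫ τ in 0..t, φ τ with hΦ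
    have hφc := hφ.continuous
    have hΦd : ∀ t, HasDerivAt Φ (φ t) t := fun t =>
      intervalIntegral.integral_hasDerivAt_right (hφc.intervalIntegrable _ _)
        hφc.stronglyMeasurable.stronglyMeasurableAtFilter hφc.continuousAt
    have hΦ' : deriv Φ = φ := funext fun t => (hΦd t).deriv
    have hΦ1 : ContDiff ℝ 1 Φ := contDiff_one_iff_deriv.2
      ⟨fun t => (hΦd t).differentiableAt, by rwa [hΦ']⟩
    have h2 := weak Φ hΦ1
    have h3 := bilin_integral_integral L hT (hφc.intervalIntegrable 0 T) (iA h0m hTm)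
    simp only [hL] at h3
    rw [hΦ', show Φ 0 = 0 by simp [Φ], zero_smul, zero_add] at h2
    simp only [r, smul_add, smul_sub]
    have j1 := ism hφc iK
    have j2 := ism hφc (intervalIntegrable_const (c := ∫ τ in 0..T, A τ (g τ))
      (μ := volume) (a := 0) (b := T))
    have j3 := ism hφc iG
    rw [intervalIntegral.integral_add j1 (j2.sub j3), intervalIntegral.integral_sub j2 j3,
      intervalIntegral.integral_smul_const, h3, ← h2]
    abel
  filter_upwards [ae_restrict_of_ae hzero, ae_restrict_mem measurableSet_Icc] with t ht htm
  rw [indicator_of_mem htm] at ht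
  rw [hsplit t htm]
  exact ht

/-- By duality, a pair orthogonal to all data must vanish. Its source component solves the adjoint
problem backwards in time with zero final value, so uniqueness for that problem kills it; the
initial component is then orthogonal to the range of `i`. -/
theorem IsParabolic.dense_data (hp : IsParabolic i B T) (hT : 0 ≤ T) :
    Dense {p : DataSpace V H T | ∃ w, IsData i B T p w} := by
  let S : Submodule ℝ (DataSpace V H T) :=
    { carrier := {p | ∃ w, IsData i B T p w}
      zero_mem' := by
        obtain ⟨p, hp⟩ := exists_isData (i := i) hp.cont (w := 0) contDiff_const
        exact ⟨_, by simpa using hp.smul 0⟩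
      add_mem' := fun ⟨w, hw⟩ ⟨z, hz⟩ => ⟨_, hw.add hz⟩
      smul_mem' := fun c _ ⟨w, hw⟩ => ⟨_, hw.smul c⟩ }
  change Dense (S : Set (DataSpace V H T))
  rw [Submodule.dense_iff_topologicalClosure_eq_top, Submodule.topologicalClosure_eq_top_iff,
    Submodule.eq_bot_iff]
  intro q hq
  have horth : ∀ w : ℝ → V, ContDiff ℝ 1 w → ⟪i (w 0), q.fst⟫_ℝ +
      ∫ t in 0..T, ⟪gram i (deriv w t) + B t (w t), q.snd t⟫_ℝ = 0 := fun w hw => by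
    obtain ⟨p, hpw⟩ := exists_isData (i := i) hp.cont hw
    have h := (Submodule.mem_orthogonal _ _).1 hq p ⟨w, hpw⟩
    rw [WithLp.prod_inner_apply, L2.inner_def] at h
    rw [intervalIntegral.integral_of_le hT, ← integral_Icc_eq_integral_Ioc]
    refine Eq.trans ?_ h
    congr 1
    · rw [← hpw.fst]; rfl
    · refine integral_congr_ae ?_
      filter_upwards [hpw.snd] with t ht
      rw [← ht]; rfl
  have hgm := Lp.memLp q.snd
  obtain ⟨h1, h2⟩ := backward_equation hT hp.cont hgm horth
  have hAg : MemLp (fun t => ContinuousLinearMap.adjoint (B t) (q.snd t)) 2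
      (volume.restrict (Icc 0 T)) := memLp_clm_apply
    ((ContinuousLinearMap.adjoint (𝕜 := ℝ) (E := V) (F := V)).continuous.comp_continuousOn
      hp.cont) hgm
  have hTm : T ∈ Icc 0 T := ⟨hT, le_rfl⟩
  have hg0 : ∀ᵐ t ∂volume.restrict (Icc 0 T), q.snd t = 0 := by
    filter_upwards [h2, ae_restrict_mem measurableSet_Icc] with s hs hsm
    have hsub : Ioc s T ⊆ Icc 0 T := fun τ hτ => ⟨hsm.1.trans hτ.1.le, hτ.2⟩
    have hμ := Measure.restrict_mono hsub (le_refl (volume : Measure ℝ))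
    -- On `[s,T]` with final value `0` the identity reads `0 = ‖i g(s)‖² + 2 ∫ ⟪g, B^* g⟫`, and both
    -- terms are nonnegative.
    have h := energy_identity (gram i) (gram_symm i) (gram_nonneg i) (eq_zero_of_gram hp.inj)
      hsm.2 (hgm.mono_measure hμ) (hAg.mono_measure hμ) (x := q.snd s) (y := 0) (by
        filter_upwards [ae_mono hμ h2, ae_restrict_mem measurableSet_Ioc] with τ hτ hτm
        have e := intervalIntegral.integral_add_adjacent_intervals
          (intervalIntegrable_of_memLp hAg hsm (hsub hτm))
          (intervalIntegrable_of_memLp hAg (hsub hτm) hTm)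
        rw [← e] at hs
        rw [eq_neg_of_add_eq_zero_left hτ, eq_neg_of_add_eq_zero_left hs]
        abel) (by rw [map_zero, hs])
    have h3 : 0 ≤ ∫ τ in s..T, ⟪q.snd τ, ContinuousLinearMap.adjoint (B τ) (q.snd τ)⟫_ℝ :=
      intervalIntegral.integral_nonneg hsm.2 fun τ hτ => by
        rw [ContinuousLinearMap.adjoint_inner_right]
        exact hp.nonneg τ ⟨hsm.1.trans hτ.1, hτ.2⟩ _
    rw [inner_gram_self, inner_gram_self, map_zero, norm_zero] at h
    have h4 : ‖i (q.snd s)‖ ^ 2 ≤ 0 := by linarith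
    exact hp.inj _ (by simpa using h4)
  have hsnd : q.snd = 0 := (Lp.eq_zero_iff_ae_eq_zero).2 hg0
  have hint : ∫ τ in 0..T, ContinuousLinearMap.adjoint (B τ) (q.snd τ) = 0 := by
    rw [intervalIntegral.integral_of_le hT, ← integral_Icc_eq_integral_Ioc]
    refine integral_eq_zero_of_ae ?_
    filter_upwards [hg0] with τ hτ
    rw [hτ]; simp
  rw [hint, add_zero] at h1
  have hfst : q.fst = 0 := hp.dense _ fun v => by
    rw [← ContinuousLinearMap.adjoint_inner_right, h1, inner_zero_right]
  exact WithLp.ofLp_injective 2 (Prod.ext hfst hsnd)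

theorem cauchySeq_of_norm_sq_le {X Y : Type*} [NormedAddCommGroup X] [NormedAddCommGroup Y]
    {C : ℝ} (hC : 0 ≤ C) {p : ℕ → X} {x : ℕ → Y} (hp : CauchySeq p)
    (h : ∀ n m, ‖x n - x m‖ ^ 2 ≤ C * ‖p n - p m‖ ^ 2) : CauchySeq x := by
  rw [Metric.cauchySeq_iff] at hp ⊢
  intro ε hε
  obtain ⟨N, hN⟩ := hp (ε / (√C + 1)) (by positivity)
  refine ⟨N, fun m hm n hn => ?_⟩
  have h1 := hN m hm n hn
  rw [dist_eq_norm] at h1 ⊢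
  rw [lt_div_iff₀ (by positivity)] at h1
  have h2 : ‖x m - x n‖ ≤ √C * ‖p m - p n‖ := by
    refine abs_le_of_sq_le_sq' ?_ (by positivity) |>.2
    rw [mul_pow, Real.sq_sqrt hC]
    exact h m n
  nlinarith [norm_nonneg (p m - p n)]

/-- Hölder on an interval of finite length; it lets time integrals pass to the limit under `L²`
convergence. -/
theorem exists_integral_norm_le {E : Type*} [NormedAddCommGroup E] (T : ℝ) :
    ∃ c : ℝ, 0 ≤ c ∧ ∀ f : Lp E 2 (volume.restrict (Icc 0 T) : Measure ℝ),
      ∫ t in Icc 0 T, ‖f t‖ ≤ c * ‖f‖ := by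
  refine ⟨((volume.restrict (Icc 0 T) : Measure ℝ) univ ^ ((1 / (1 : ENNReal).toReal) -
    1 / (2 : ENNReal).toReal)).toReal, ENNReal.toReal_nonneg, fun f => ?_⟩
  have h := eLpNorm_le_eLpNorm_mul_rpow_measure_univ (p := 1) (q := 2) one_le_two
    (Lp.memLp f).1
  have hne : (volume.restrict (Icc 0 T) : Measure ℝ) univ ^ ((1 / (1 : ENNReal).toReal) -
    1 / (2 : ENNReal).toReal) ≠ ⊤ :=
    (ENNReal.rpow_lt_top_of_nonneg (by norm_num) (measure_ne_top _ _)).ne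
  have h2 := ENNReal.toReal_mono (ENNReal.mul_ne_top (Lp.memLp f).2.ne hne) h
  rw [ENNReal.toReal_mul, mul_comm] at h2
  rwa [Lp.norm_def, integral_norm_eq_lintegral_enorm (Lp.memLp f).1,
    ← eLpNorm_one_eq_lintegral_enorm]

/-- Existence of weak solutions, with continuous dependence on the initial value. -/
theorem IsParabolic.exists_isWeakSol (hp : IsParabolic i B T) (hT : 0 ≤ T) :
    ∃ C : ℝ, 0 ≤ C ∧ ∀ u₀ : H, ∃ u w, IsWeakSol i B T u w ∧ u 0 = u₀ ∧
      ∀ t ∈ Icc 0 T, ‖u t‖ ^ 2 ≤ C * ‖u₀‖ ^ 2 := by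
  obtain ⟨C, hC, hap⟩ := hp.exists_apriori hT
  refine ⟨C, hC, fun u₀ => ?_⟩
  have ap1 : ∀ {p : DataSpace V H T} {w}, IsData i B T p w → ∀ t ∈ Icc 0 T,
      ‖i (w t)‖ ^ 2 ≤ C * ‖p‖ ^ 2 := fun {p w} h => by
    rw [h.norm_sq hT]; exact (hap w h.contDiff).1
  have ap2 : ∀ {p : DataSpace V H T} {w}, IsData i B T p w →
      ∫ τ in Icc 0 T, ‖w τ‖ ^ 2 ≤ C * ‖p‖ ^ 2 := fun {p w} h => by
    rw [h.norm_sq hT, integral_Icc_eq_integral_Ioc, ← intervalIntegral.integral_of_le hT]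
    exact (hap w h.contDiff).2
  obtain ⟨p, hpmem, hplim⟩ := mem_closure_iff_seq_limit.1
    (hp.dense_data hT (WithLp.toLp 2 (u₀, 0)))
  choose w hw using hpmem
  have hpc := hplim.cauchySeq
  have h0m : (0 : ℝ) ∈ Icc 0 T := ⟨le_rfl, hT⟩
  have hwm : ∀ n, MemLp (w n) 2 (volume.restrict (Icc 0 T)) := fun n =>
    memLp_of_continuousOn (hw n).contDiff.continuous.continuousOn
  obtain ⟨wl, hwl⟩ := cauchySeq_tendsto_of_complete
    (cauchySeq_of_norm_sq_le hC hpc (x := fun n => (hwm n).toLp) fun n m => by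
      refine le_trans (le_of_eq ?_) (ap2 ((hw n).sub (hw m)))
      rw [norm_sq_eq_integral, ← MemLp.toLp_sub]
      refine integral_congr_ae ?_
      filter_upwards [((hwm n).sub (hwm m)).coeFn_toLp] with t ht
      rw [ht])
  have hex : ∀ t ∈ Icc 0 T, ∃ y, Tendsto (fun n => i (w n t)) atTop (𝓝 y) := fun t ht =>
    cauchySeq_tendsto_of_complete (cauchySeq_of_norm_sq_le hC hpc fun n m => by
      have := ap1 ((hw n).sub (hw m)) t ht
      rwa [Pi.sub_apply, map_sub] at this)
  choose! u hu using hex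
  -- The a priori bound for `w m - w n` does not depend on `t`; sending `m → ∞` gives a uniform
  -- rate, hence continuity of `u`.
  have hunif : TendstoUniformlyOn (fun n t => i (w n t)) u atTop (Icc 0 T) := by
    have hb : ∀ n, ∀ t ∈ Icc 0 T, ‖u t - i (w n t)‖ ≤ √C * ‖WithLp.toLp 2 (u₀, 0) - p n‖ := by
      intro n t ht
      have l1 : Tendsto (fun m => ‖i (w m t) - i (w n t)‖ ^ 2) atTop (𝓝 (‖u t - i (w n t)‖ ^ 2)) :=
        ((hu t ht).sub_const _).norm.pow 2
      have l2 : Tendsto (fun m => C * ‖p m - p n‖ ^ 2) atTop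
          (𝓝 (C * ‖WithLp.toLp 2 (u₀, 0) - p n‖ ^ 2)) :=
        ((hplim.sub_const _).norm.pow 2).const_mul C
      have h := le_of_tendsto_of_tendsto' l1 l2 fun m => by
        have := ap1 ((hw m).sub (hw n)) t ht
        rwa [Pi.sub_apply, map_sub] at this
      refine abs_le_of_sq_le_sq' ?_ (by positivity) |>.2
      rwa [mul_pow, Real.sq_sqrt hC]
    have l3 : Tendsto (fun n => √C * ‖WithLp.toLp 2 (u₀, 0) - p n‖) atTop (𝓝 0) := by
      simpa using (hplim.const_sub (WithLp.toLp 2 (u₀, 0))).norm.const_mul √C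
    rw [Metric.tendstoUniformlyOn_iff]
    intro ε hε
    filter_upwards [l3.eventually_lt_const hε] with n hn t ht
    rw [dist_eq_norm]
    exact (hb n t ht).trans_lt hn
  have hfst : Tendsto (fun n => (p n).fst) atTop (𝓝 u₀) :=
    ((WithLp.fstL 2 ℝ H (Lp V 2 (volume.restrict (Icc 0 T)))).continuous.tendsto _).comp hplim
  have hsnd : Tendsto (fun n => (p n).snd) atTop (𝓝 0) :=
    ((WithLp.sndL 2 ℝ H (Lp V 2 (volume.restrict (Icc 0 T)))).continuous.tendsto _).comp hplim
  have hu0 : u 0 = u₀ := tendsto_nhds_unique (hu 0 h0m) (by simpa only [(hw _).fst] using hfst)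
  refine ⟨u, wl, ⟨?_, Lp.memLp wl, ?_, fun t ht => ?_⟩, hu0, fun t ht => ?_⟩
  · exact hunif.continuousOn (Frequently.of_forall fun n =>
      (i.continuous.comp (hw n).contDiff.continuous).continuousOn)
  -- A subsequence converging almost everywhere in `V` identifies the `L²` limit `wl` with the
  -- pointwise limit `u`.
  · obtain ⟨ns, hns, hae⟩ := (tendstoInMeasure_of_tendsto_Lp hwl).exists_seq_tendsto_ae
    have hall : ∀ᵐ t ∂volume.restrict (Icc 0 T), ∀ n, (hwm n).toLp (w n) t = w n t :=
      ae_all_iff.2 fun n => (hwm n).coeFn_toLp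
    filter_upwards [hae, hall, ae_restrict_mem measurableSet_Icc] with t h1 h2 ht
    simp only [h2] at h1
    exact tendsto_nhds_unique ((i.continuous.tendsto _).comp h1) ((hu t ht).comp hns.tendsto_atTop)
  · obtain ⟨c, hc0, hc⟩ := exists_integral_norm_le (E := V) T
    obtain ⟨b, hb⟩ := isCompact_Icc.exists_bound_of_continuousOn hp.cont
    have hsub : Ioc 0 t ⊆ Icc 0 T := fun τ hτ => ⟨hτ.1.le, hτ.2.trans ht.2⟩
    have hμ := Measure.restrict_mono hsub (le_refl (volume : Measure ℝ))
    have small : ∀ {x : ℕ → Lp V 2 (volume.restrict (Icc 0 T) : Measure ℝ)},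
        Tendsto x atTop (𝓝 0) →
        Tendsto (fun n => ∫ τ in Icc 0 T, ‖x n τ‖) atTop (𝓝 0) := fun {x} hx => by
      refine squeeze_zero (fun n => integral_nonneg fun τ => norm_nonneg _) (fun n => hc _) ?_
      simpa using hx.norm.const_mul c
    have bound : ∀ (f : Lp V 2 (volume.restrict (Icc 0 T) : Measure ℝ)) (z : ℝ → V) (b : ℝ),
        (∀ᵐ τ ∂volume.restrict (Icc 0 T), ‖z τ‖ ≤ b * ‖f τ‖) →
        ‖∫ τ in 0..t, z τ‖ ≤ |b| * ∫ τ in Icc 0 T, ‖f τ‖ := fun f z b hz => by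
      have hfi : Integrable (fun τ => |b| * ‖f τ‖) (volume.restrict (Icc 0 T)) :=
        ((Lp.memLp f).integrable one_le_two).norm.const_mul _
      rw [intervalIntegral.integral_of_le ht.1, ← integral_const_mul]
      refine (norm_integral_le_of_norm_le (hfi.mono_measure hμ) ?_).trans
        (integral_mono_measure hμ (Eventually.of_forall fun τ => by positivity) hfi)
      filter_upwards [ae_mono hμ hz] with τ hτ
      exact hτ.trans (by gcongr; exact le_abs_self b)
    have hBm : ∀ n, MemLp (fun τ => B τ (w n τ)) 2 (volume.restrict (Icc 0 T)) := fun n =>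
      memLp_clm_apply hp.cont (hwm n)
    have hBwl := memLp_clm_apply hp.cont (Lp.memLp wl)
    have lB : Tendsto (fun n => ∫ τ in 0..t, B τ (w n τ)) atTop
        (𝓝 (∫ τ in 0..t, B τ (wl τ))) := by
      rw [tendsto_iff_norm_sub_tendsto_zero]
      have hx : Tendsto (fun n => (hwm n).toLp - wl) atTop (𝓝 0) := by
        simpa using hwl.sub_const wl
      have hs := (small hx).const_mul |b|
      rw [mul_zero] at hs
      refine squeeze_zero (fun n => norm_nonneg _) (fun n => ?_) hs
      rw [← intervalIntegral.integral_sub (intervalIntegrable_of_memLp (hBm n) h0m ht)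
        (intervalIntegrable_of_memLp hBwl h0m ht)]
      refine bound _ _ b ?_
      filter_upwards [Lp.coeFn_sub (hwm n).toLp wl, (hwm n).coeFn_toLp,
        ae_restrict_mem measurableSet_Icc] with τ h1 h2 hτ
      rw [h1, Pi.sub_apply, h2, ← map_sub]
      exact (B τ).le_of_opNorm_le (hb τ hτ) _
    have lf : Tendsto (fun n => ∫ τ in 0..t, (p n).snd τ) atTop (𝓝 0) := by
      rw [tendsto_zero_iff_norm_tendsto_zero]
      have hs := (small hsnd).const_mul |(1 : ℝ)|
      rw [mul_zero] at hs
      exact squeeze_zero (fun n => norm_nonneg _) (fun n => bound _ _ 1 (by simp)) hs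
    have key : ∀ n, gram i (w n t) + ∫ τ in 0..t, B τ (w n τ) =
        gram i (w n 0) + ∫ τ in 0..t, (p n).snd τ := fun n => by
      have hd : ∀ τ ∈ uIcc 0 t, HasDerivAt (fun τ => gram i (w n τ)) (gram i (deriv (w n) τ)) τ :=
        fun τ _ => (gram i).hasFDerivAt.comp_hasDerivAt τ
          ((hw n).contDiff.differentiable (by simp) τ).hasDerivAt
      have hK : IntervalIntegrable (fun τ => gram i (deriv (w n) τ)) volume 0 t :=
        ((gram i).continuous.comp ((hw n).contDiff.continuous_deriv le_rfl)).intervalIntegrable _ _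
      have e1 := intervalIntegral.integral_eq_sub_of_hasDerivAt hd hK
      have e2 : ∫ τ in 0..t, (p n).snd τ =
          ∫ τ in 0..t, (gram i (deriv (w n) τ) + B τ (w n τ)) := by
        rw [intervalIntegral.integral_of_le ht.1, intervalIntegral.integral_of_le ht.1]
        exact integral_congr_ae (ae_mono hμ (hw n).snd)
      rw [e2, intervalIntegral.integral_add hK (intervalIntegrable_of_memLp (hBm n) h0m ht), e1]
      abel
    have ladj : ∀ τ ∈ Icc 0 T, Tendsto (fun n => gram i (w n τ)) atTop
        (𝓝 (ContinuousLinearMap.adjoint i (u τ))) := fun τ hτ =>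
      ((ContinuousLinearMap.adjoint i).continuous.tendsto _).comp (hu τ hτ)
    refine tendsto_nhds_unique ((ladj t ht).add lB) ?_
    simp only [key]
    simpa using (ladj 0 h0m).add lf
  · have l1 := (hu t ht).norm.pow 2
    have l2 := (hplim.norm.pow 2).const_mul C
    have h := le_of_tendsto_of_tendsto' l1 l2 fun n => ap1 (hw n) t ht
    rwa [WithLp.prod_norm_sq_eq_of_L2 (WithLp.toLp 2 (u₀, (0 : Lp V 2 _))), WithLp.toLp_snd,
      WithLp.toLp_fst, norm_zero, zero_pow two_ne_zero, add_zero] at h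

end Existence

/-- Riesz representation of a bounded bilinear form by an operator. -/
theorem exists_operator_of_bilin {V : Type*} [NormedAddCommGroup V] [InnerProductSpace ℝ V]
    [CompleteSpace V] (b : V →L[ℝ] V →L[ℝ] ℝ) : ∃ S : V →L[ℝ] V, ∀ u v, ⟪S u, v⟫_ℝ = b u v :=
  ⟨InnerProductSpace.continuousLinearMapOfBilin (𝕜 := ℝ) b, fun u v =>
    InnerProductSpace.continuousLinearMapOfBilin_apply b u v⟩

/-! ### The space `H¹`, its embedding into `L²`, and the forms given by the coefficients. -/

section Sobolev

variable {n : ℕ}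

theorem inner_L2_eq (f g : L2 n) : ⟪f, g⟫_ℝ = ∫ x, f x * g x := by
  rw [L2.inner_def]
  simp only [RCLike.inner_apply, conj_trivial, mul_comm]

theorem inner_toLp {φ : Rn n → ℝ} (hφ : MemLp φ 2) (f : L2 n) :
    ⟪f, hφ.toLp φ⟫_ℝ = ∫ x, f x * φ x := by
  rw [inner_L2_eq]
  refine integral_congr_ae ?_
  filter_upwards [hφ.coeFn_toLp] with x hx
  rw [hx]

theorem memLp_test {φ : Rn n → ℝ} (hφ : ContDiff ℝ ∞ φ) (hc : HasCompactSupport φ) : MemLp φ 2 :=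
  hφ.continuous.memLp_of_hasCompactSupport hc

theorem continuous_partial (j : Fin n) {φ : Rn n → ℝ} (hφ : ContDiff ℝ ∞ φ) :
    Continuous fun x => fderiv ℝ φ x (EuclideanSpace.single j 1) :=
  (hφ.continuous_fderiv (by simp)).clm_apply continuous_const

theorem memLp_partial_test (j : Fin n) {φ : Rn n → ℝ} (hφ : ContDiff ℝ ∞ φ)
    (hc : HasCompactSupport φ) :
    MemLp (fun x => fderiv ℝ φ x (EuclideanSpace.single j 1)) 2 :=
  (continuous_partial j hφ).memLp_of_hasCompactSupport (hc.fderiv_apply (𝕜 := ℝ) _)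

/-- Each test function imposes an equation between continuous functionals, so the space is an
intersection of closed sets. Completeness of `H¹` follows. -/
theorem isClosed_sobolevH1 : IsClosed (sobolevH1 n : Set (WithLp 2 (L2 n × PiLp 2
    fun _ : Fin n => L2 n))) := by
  have : (sobolevH1 n : Set (WithLp 2 (L2 n × PiLp 2 fun _ : Fin n => L2 n))) =
      ⋂ (j : Fin n) (φ : Rn n → ℝ) (hφ : ContDiff ℝ ∞ φ) (hc : HasCompactSupport φ),
        {p | ⟪p.fst, (memLp_partial_test j hφ hc).toLp⟫_ℝ =
          -⟪p.snd j, (memLp_test hφ hc).toLp⟫_ℝ} := by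
    ext p
    simp only [mem_iInter, mem_ofPred_eq, inner_toLp]
    rfl
  rw [this]
  refine isClosed_iInter fun j => isClosed_iInter fun φ => isClosed_iInter fun hφ =>
    isClosed_iInter fun hc => isClosed_eq ?_ ?_
  · exact (WithLp.fstL 2 ℝ (L2 n) (PiLp 2 fun _ : Fin n => L2 n)).continuous.inner
      continuous_const
  · exact (((PiLp.proj (𝕜 := ℝ) 2 (fun _ : Fin n => L2 n) j).continuous.comp
      (WithLp.sndL 2 ℝ (L2 n) (PiLp 2 fun _ : Fin n => L2 n)).continuous).inner
        continuous_const).neg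

instance instCompleteSpaceH1 : CompleteSpace (H1 n) :=
  isClosed_sobolevH1.completeSpace_coe

/-- The embedding of `H¹` into `L²`. -/
noncomputable def fnL (n : ℕ) : H1 n →L[ℝ] L2 n :=
  (WithLp.fstL 2 ℝ (L2 n) (PiLp 2 fun _ : Fin n => L2 n)).comp (sobolevH1 n).subtypeL

theorem fnL_apply (u : H1 n) : fnL n u = u.fn := rfl

theorem H1.norm_sq_eq (u : H1 n) : ‖u‖ ^ 2 = ‖u.fn‖ ^ 2 + ∑ j, ‖u.partialDeriv j‖ ^ 2 := by
  change ‖(u : WithLp 2 (L2 n × PiLp 2 fun _ : Fin n => L2 n))‖ ^ 2 = _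
  rw [WithLp.prod_norm_sq_eq_of_L2, PiLp.norm_sq_eq_of_L2]
  rfl

theorem H1.norm_partialDeriv_le (u : H1 n) (j : Fin n) : ‖u.partialDeriv j‖ ≤ ‖u‖ := by
  refine abs_le_of_sq_le_sq' ?_ (norm_nonneg _) |>.2
  rw [u.norm_sq_eq]
  have := Finset.single_le_sum (f := fun j => ‖u.partialDeriv j‖ ^ 2)
    (fun _ _ => by positivity) (Finset.mem_univ j)
  have h0 : 0 ≤ ‖u.fn‖ ^ 2 := by positivity
  linarith

theorem L2.eq_zero_of_test (f : L2 n)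
    (h : ∀ φ : Rn n → ℝ, ContDiff ℝ ∞ φ → HasCompactSupport φ → ∫ x, f x * φ x = 0) : f = 0 := by
  refine Lp.eq_zero_iff_ae_eq_zero.2 ?_
  refine ae_eq_zero_of_integral_contDiff_smul_eq_zero
    ((Lp.memLp f).locallyIntegrable one_le_two) fun φ hφ hc => ?_
  simpa only [smul_eq_mul, mul_comm] using h φ hφ hc

/-- Elements are pairs of a function and a gradient, so this is uniqueness of weak derivatives. -/
theorem fnL_injective (u : H1 n) (hu : fnL n u = 0) : u = 0 := by
  have hf : u.fn = 0 := hu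
  have hd : ∀ j, u.partialDeriv j = 0 := fun j => L2.eq_zero_of_test _ fun φ hφ hc => by
    have h : ∫ x, u.fn x * fderiv ℝ φ x (EuclideanSpace.single j 1) =
      -∫ x, u.partialDeriv j x * φ x := u.2 j φ hφ hc
    rw [← inner_toLp (memLp_partial_test j hφ hc), hf, inner_zero_left] at h
    linarith
  have := u.norm_sq_eq
  simp only [hf, hd, norm_zero, ne_eq, OfNat.ofNat_ne_zero, not_false_eq_true, zero_pow,
    Finset.sum_const_zero, add_zero] at this
  simpa using this

/-- Test functions as elements of `H¹`. -/
theorem exists_H1_of_test {φ : Rn n → ℝ} (hφ : ContDiff ℝ ∞ φ) (hc : HasCompactSupport φ) :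
    ∃ u : H1 n, u.fn = (memLp_test hφ hc).toLp := by
  refine ⟨⟨WithLp.toLp 2 ((memLp_test hφ hc).toLp,
    WithLp.toLp 2 fun j => (memLp_partial_test j hφ hc).toLp), fun j ψ hψ hψc => ?_⟩, rfl⟩
  have e1 : ∫ x, (memLp_test hφ hc).toLp φ x * fderiv ℝ ψ x (EuclideanSpace.single j 1) =
      ∫ x, φ x * fderiv ℝ ψ x (EuclideanSpace.single j 1) := by
    refine integral_congr_ae ?_
    filter_upwards [(memLp_test hφ hc).coeFn_toLp] with x hx
    rw [hx]
  have e2 : ∫ x, (memLp_partial_test j hφ hc).toLp _ x * ψ x =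
      ∫ x, fderiv ℝ φ x (EuclideanSpace.single j 1) * ψ x := by
    refine integral_congr_ae ?_
    filter_upwards [(memLp_partial_test j hφ hc).coeFn_toLp] with x hx
    rw [hx]
  change ∫ x, (memLp_test hφ hc).toLp φ x * fderiv ℝ ψ x (EuclideanSpace.single j 1) =
    -∫ x, (memLp_partial_test j hφ hc).toLp _ x * ψ x
  rw [e1, e2]
  refine integral_mul_fderiv_eq_neg_fderiv_mul_of_integrable ?_ ?_ ?_
    (fun x _ => hφ.differentiable (by simp) x) (fun x _ => hψ.differentiable (by simp) x)
  · exact (memLp_partial_test j hφ hc).integrable_mul (q := 2) (memLp_test hψ hψc)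
  · exact (memLp_test hφ hc).integrable_mul (q := 2) (memLp_partial_test j hψ hψc)
  · exact (memLp_test hφ hc).integrable_mul (q := 2) (memLp_test hψ hψc)

theorem fnL_dense (h : L2 n) (hh : ∀ u, ⟪fnL n u, h⟫_ℝ = 0) : h = 0 := by
  refine L2.eq_zero_of_test h fun φ hφ hc => ?_
  obtain ⟨u, hu⟩ := exists_H1_of_test hφ hc
  have := hh u
  rwa [fnL_apply, hu, real_inner_comm, inner_toLp] at this

/-! ### Bounded bilinear forms in the gradients -/

theorem integrable_coeff_mul {m : Rn n → ℝ} (hm : Continuous m) {C : ℝ} (hC : ∀ x, |m x| ≤ C)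
    (f g : L2 n) : Integrable fun x => m x * f x * g x := by
  have h : Integrable fun x => f x * g x := (Lp.memLp f).integrable_mul (q := 2) (Lp.memLp g)
  have := h.bdd_mul (c := C) hm.aestronglyMeasurable (Eventually.of_forall hC)
  simpa only [mul_assoc] using this

theorem abs_integral_coeff_le {m : Rn n → ℝ} {C : ℝ}
    (hC : ∀ x, |m x| ≤ C) (f g : L2 n) : |∫ x, m x * f x * g x| ≤ C * (‖f‖ * ‖g‖) := by
  have hC0 : 0 ≤ C := (abs_nonneg _).trans (hC 0)
  have h : Integrable fun x => |f x| * |g x| :=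
    (Lp.memLp f).norm.integrable_mul (q := 2) (Lp.memLp g).norm
  have h1 : ∫ x, |f x| * |g x| ≤ ‖f‖ * ‖g‖ := by
    have h2 := real_inner_le_norm |f| |g|
    rw [norm_abs_eq_norm, norm_abs_eq_norm, inner_L2_eq] at h2
    have h3 : ∫ x, |f x| * |g x| = ∫ x, |f| x * |g| x := integral_congr_ae <| by
      filter_upwards [Lp.coeFn_abs f, Lp.coeFn_abs g] with x hf hg
      rw [hf, hg]
    rwa [h3]
  calc |∫ x, m x * f x * g x| ≤ ∫ x, C * (|f x| * |g x|) := by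
        rw [← Real.norm_eq_abs]
        refine norm_integral_le_of_norm_le (h.const_mul C) (Eventually.of_forall fun x => ?_)
        rw [Real.norm_eq_abs, abs_mul, abs_mul, mul_assoc]
        gcongr
        exact hC x
    _ = C * ∫ x, |f x| * |g x| := integral_const_mul _ _
    _ ≤ C * (‖f‖ * ‖g‖) := by gcongr

/-- A coefficient matrix with bounded continuous entries. -/
def IsBddCoeff (m : Rn n → Matrix (Fin n) (Fin n) ℝ) (C : ℝ) : Prop :=
  ∀ j k, Continuous (fun x => m x j k) ∧ ∀ x, |m x j k| ≤ C

/-- The bilinear form `∫ ∑ⱼₖ mⱼₖ ∂ⱼu ∂ₖv`. -/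
noncomputable def coeffForm (m : Rn n → Matrix (Fin n) (Fin n) ℝ) (u v : H1 n) : ℝ :=
  ∫ x, ∑ j, ∑ k, m x j k * u.partialDeriv j x * v.partialDeriv k x

theorem aForm_eq (a : ℝ → Rn n → Matrix (Fin n) (Fin n) ℝ) (t : ℝ) (u v : H1 n) :
    aForm a t u v = coeffForm (a t) u v := rfl

theorem coeffForm_eq_sum {m : Rn n → Matrix (Fin n) (Fin n) ℝ} {C : ℝ} (hm : IsBddCoeff m C)
    (u v : H1 n) : coeffForm m u v =
      ∑ j, ∑ k, ∫ x, m x j k * u.partialDeriv j x * v.partialDeriv k x := by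
  have h : ∀ j k, Integrable fun x => m x j k * u.partialDeriv j x * v.partialDeriv k x :=
    fun j k => integrable_coeff_mul (hm j k).1 (hm j k).2 _ _
  rw [coeffForm, integral_finsetSum _ fun j _ => integrable_finsetSum _ fun k _ => h j k]
  exact Finset.sum_congr rfl fun j _ => integral_finsetSum _ fun k _ => h j k

theorem abs_coeffForm_le {m : Rn n → Matrix (Fin n) (Fin n) ℝ} {C : ℝ} (hC : 0 ≤ C)
    (hm : IsBddCoeff m C) (u v : H1 n) :
    |coeffForm m u v| ≤ n * (n * C) * ‖u‖ * ‖v‖ := by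
  rw [coeffForm_eq_sum hm]
  calc |∑ j, ∑ k, ∫ x, m x j k * u.partialDeriv j x * v.partialDeriv k x|
      ≤ ∑ j : Fin n, ∑ k : Fin n, C * (‖u‖ * ‖v‖) := by
        refine (Finset.abs_sum_le_sum_abs _ _).trans (Finset.sum_le_sum fun j _ => ?_)
        refine (Finset.abs_sum_le_sum_abs _ _).trans (Finset.sum_le_sum fun k _ => ?_)
        refine (abs_integral_coeff_le (hm j k).2 _ _).trans ?_
        gcongr
        · exact u.norm_partialDeriv_le j
        · exact v.norm_partialDeriv_le k
    _ = n * (n * C) * ‖u‖ * ‖v‖ := by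
        simp only [Finset.sum_const, Finset.card_univ, Fintype.card_fin, nsmul_eq_mul]; ring

theorem integral_coeff_add {m : Rn n → ℝ} (hm : Continuous m) {C : ℝ} (hC : ∀ x, |m x| ≤ C)
    (f f' g : L2 n) : ∫ x, m x * (f + f') x * g x =
      (∫ x, m x * f x * g x) + ∫ x, m x * f' x * g x := by
  rw [← integral_add (integrable_coeff_mul hm hC f g) (integrable_coeff_mul hm hC f' g)]
  refine integral_congr_ae ?_
  filter_upwards [Lp.coeFn_add f f'] with x hx
  rw [hx, Pi.add_apply]; ring

theorem integral_coeff_smul (m : Rn n → ℝ) (c : ℝ) (f g : L2 n) :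
    ∫ x, m x * (c • f) x * g x = c * ∫ x, m x * f x * g x := by
  rw [← integral_const_mul]
  refine integral_congr_ae ?_
  filter_upwards [Lp.coeFn_smul c f] with x hx
  rw [hx, Pi.smul_apply, smul_eq_mul]; ring

/-- Reduces linearity in the second argument to linearity in the first, and yields symmetry of the
form when the matrix is symmetric. -/
theorem coeffForm_swap (m : Rn n → Matrix (Fin n) (Fin n) ℝ) (u v : H1 n) :
    coeffForm m u v = coeffForm (fun x => (m x).transpose) v u := by
  unfold coeffForm
  congr 1
  ext x
  rw [Finset.sum_comm]
  refine Finset.sum_congr rfl fun k _ => Finset.sum_congr rfl fun j _ => ?_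
  change _ = m x j k * _ * _
  ring

theorem IsBddCoeff.transpose {m : Rn n → Matrix (Fin n) (Fin n) ℝ} {C : ℝ}
    (hm : IsBddCoeff m C) : IsBddCoeff (fun x => (m x).transpose) C := fun j k => hm k j

theorem coeffForm_add_left {m : Rn n → Matrix (Fin n) (Fin n) ℝ} {C : ℝ} (hm : IsBddCoeff m C)
    (u u' v : H1 n) : coeffForm m (u + u') v = coeffForm m u v + coeffForm m u' v := by
  simp only [coeffForm_eq_sum hm, ← Finset.sum_add_distrib]
  refine Finset.sum_congr rfl fun j _ => Finset.sum_congr rfl fun k _ => ?_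
  exact integral_coeff_add (hm j k).1 (hm j k).2 _ _ _

theorem coeffForm_smul_left {m : Rn n → Matrix (Fin n) (Fin n) ℝ} {C : ℝ} (hm : IsBddCoeff m C)
    (c : ℝ) (u v : H1 n) : coeffForm m (c • u) v = c * coeffForm m u v := by
  simp only [coeffForm_eq_sum hm, Finset.mul_sum]
  refine Finset.sum_congr rfl fun j _ => Finset.sum_congr rfl fun k _ => ?_
  exact integral_coeff_smul _ _ _ _

/-- The bounded operator on `H¹` representing the form. -/
theorem IsBddCoeff.exists_operator {m : Rn n → Matrix (Fin n) (Fin n) ℝ} {C : ℝ} (hC : 0 ≤ C)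
    (hm : IsBddCoeff m C) : ∃ S : H1 n →L[ℝ] H1 n, ∀ u v, ⟪S u, v⟫_ℝ = coeffForm m u v := by
  let b : H1 n →L[ℝ] H1 n →L[ℝ] ℝ := LinearMap.mkContinuous₂
    (LinearMap.mk₂ ℝ (coeffForm m) (coeffForm_add_left hm) (coeffForm_smul_left hm)
      (fun u v v' => by
        rw [coeffForm_swap, coeffForm_add_left hm.transpose, coeffForm_swap m u v,
          coeffForm_swap m u v'])
      (fun c u v => by
        rw [coeffForm_swap, coeffForm_smul_left hm.transpose, coeffForm_swap m u v]; rfl))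
    (n * (n * C)) fun u v => abs_coeffForm_le hC hm u v
  exact exists_operator_of_bilin (V := H1 n) b

theorem coeffForm_sub {m m' : Rn n → Matrix (Fin n) (Fin n) ℝ} {C C' : ℝ} (hm : IsBddCoeff m C)
    (hm' : IsBddCoeff m' C') (u v : H1 n) :
    coeffForm m u v - coeffForm m' u v = coeffForm (fun x => m x - m' x) u v := by
  have hs : IsBddCoeff (fun x => m x - m' x) (C + C') := fun j k =>
    ⟨(hm j k).1.sub (hm' j k).1, fun x =>
      (abs_sub _ _).trans (add_le_add ((hm j k).2 x) ((hm' j k).2 x))⟩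
  rw [coeffForm_eq_sum hm, coeffForm_eq_sum hm', coeffForm_eq_sum hs, ← Finset.sum_sub_distrib]
  refine Finset.sum_congr rfl fun j _ => ?_
  rw [← Finset.sum_sub_distrib]
  refine Finset.sum_congr rfl fun k _ => ?_
  rw [← integral_sub (integrable_coeff_mul (hm j k).1 (hm j k).2 _ _)
    (integrable_coeff_mul (hm' j k).1 (hm' j k).2 _ _)]
  congr 1
  ext x
  rw [Matrix.sub_apply]; ring

variable {a : ℝ → Rn n → Matrix (Fin n) (Fin n) ℝ} {T κ : ℝ}

theorem IsAdmissible.exists_isBddCoeff (ha : IsAdmissible a T κ) :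
    ∃ C, 0 ≤ C ∧ ∀ t ∈ Icc 0 T, IsBddCoeff (a t) C := by
  obtain ⟨C, hC⟩ := ha.lip
  refine ⟨|C|, abs_nonneg C, fun t ht j k => ⟨?_, fun x => ((hC t ht j k).1 x).trans
    (le_abs_self C)⟩⟩
  refine (LipschitzWith.of_dist_le_mul (K := ⟨|C|, abs_nonneg C⟩) fun x y => ?_).continuous
  rw [Real.dist_eq, dist_eq_norm]
  refine ((hC t ht j k).2 x y).trans ?_
  change _ ≤ |C| * _
  gcongr
  exact le_abs_self C

theorem integral_sum_sq_partialDeriv (u : H1 n) :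
    Integrable (fun x => ∑ j, u.partialDeriv j x ^ 2) ∧
      ∫ x, ∑ j, u.partialDeriv j x ^ 2 = ∑ j, ‖u.partialDeriv j‖ ^ 2 := by
  have h : ∀ j, Integrable fun x => u.partialDeriv j x ^ 2 := fun j =>
    (Lp.memLp (u.partialDeriv j)).integrable_sq
  refine ⟨integrable_finsetSum _ fun j _ => h j, ?_⟩
  rw [integral_finsetSum _ fun j _ => h j]
  refine Finset.sum_congr rfl fun j _ => ?_
  rw [norm_sq_eq_integral]
  simp only [Real.norm_eq_abs, sq_abs]

theorem IsAdmissible.aForm_self (ha : IsAdmissible a T κ) {t : ℝ} (ht : t ∈ Icc 0 T) (u : H1 n) :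
    κ * ∑ j, ‖u.partialDeriv j‖ ^ 2 ≤ aForm a t u u ∧
      aForm a t u u ≤ 1 / κ * ∑ j, ‖u.partialDeriv j‖ ^ 2 := by
  obtain ⟨C, hC0, hC⟩ := ha.exists_isBddCoeff
  obtain ⟨hi, he⟩ := integral_sum_sq_partialDeriv u
  have hint : Integrable fun x =>
      ∑ j, ∑ k, a t x j k * u.partialDeriv j x * u.partialDeriv k x :=
    integrable_finsetSum _ fun j _ => integrable_finsetSum _ fun k _ =>
      integrable_coeff_mul (hC t ht j k).1 (hC t ht j k).2 _ _
  -- Ellipticity is applied pointwise with `ξ = ∇u(x)` and then integrated.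
  have hell := fun x => ha.elliptic t ht x (WithLp.toLp 2 fun j => u.partialDeriv j x)
  simp only [EuclideanSpace.real_norm_sq_eq] at hell
  rw [← he, ← integral_const_mul, ← integral_const_mul, aForm]
  exact ⟨integral_mono (hi.const_mul _) hint fun x => (hell x).1,
    integral_mono hint (hi.const_mul _) fun x => (hell x).2⟩

/-- The Log-Lipschitz modulus vanishes at `0` because `r log r` extends continuously there. This is
all that existence and uniqueness need of the time regularity: `t ↦ B t` is continuous in operator
norm. -/
theorem tendsto_logLip_modulus (t : ℝ) (D : ℝ) :
    Tendsto (fun s => D * (|s - t| * (1 + |Real.log (|s - t|)|))) (𝓝 t) (𝓝 0) := by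
  have hc : Continuous fun s : ℝ => D * (|s - t| + |(|s - t| * Real.log |s - t|)|) := by
    have h1 : Continuous fun s : ℝ => |s - t| := by fun_prop
    exact continuous_const.mul (h1.add (Real.continuous_mul_log.comp h1).abs)
  have := hc.tendsto t
  simp only [sub_self, abs_zero, zero_mul, add_zero, mul_zero] at this
  refine this.congr fun s => ?_
  rw [abs_mul, abs_abs]; ring

/-- The abstract parabolic problem associated with admissible coefficients. -/
theorem IsAdmissible.exists_isParabolic (ha : IsAdmissible a T κ) :
    ∃ B : ℝ → H1 n →L[ℝ] H1 n, (∀ t ∈ Icc 0 T, ∀ u v, ⟪B t u, v⟫_ℝ = aForm a t u v) ∧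
      IsParabolic (V := H1 n) (H := L2 n) (fnL n) B T := by
  obtain ⟨C, hC0, hC⟩ := ha.exists_isBddCoeff
  have hex : ∀ t ∈ Icc 0 T, ∃ S : H1 n →L[ℝ] H1 n, ∀ u v, ⟪S u, v⟫_ℝ = aForm a t u v :=
    fun t ht => (hC t ht).exists_operator hC0
  choose! B hB using hex
  refine ⟨B, hB, fnL_injective, fnL_dense, fun t ht => ?_, fun t ht u => ?_, κ, ha.kappa_pos,
    fun t ht u => ?_⟩
  · obtain ⟨D, hD⟩ := ha.logLip
    have hle : ∀ s ∈ Icc 0 T, |s - t| ≤ 1 →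
        ‖B s - B t‖ ≤ (n * (n * |D|)) * (|s - t| * (1 + |Real.log (|s - t|)|)) := by
      intro s hs hst
      rcases eq_or_ne s t with rfl | hne
      · rw [sub_self, ContinuousLinearMap.opNorm_zero]
        positivity
      have hst0 : 0 < |s - t| := abs_pos.2 (sub_ne_zero.2 hne)
      set r := |D| * (|s - t| * (1 + |Real.log (|s - t|)|)) with hr
      have hr0 : 0 ≤ r := by positivity
      have hm : IsBddCoeff (fun x => a s x - a t x) r := fun j k =>
        ⟨(hC s hs j k).1.sub (hC t ht j k).1, fun x => (hD s hs t ht hst0 hst x j k).trans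
          (by rw [hr]; gcongr; exact le_abs_self D)⟩
      refine ContinuousLinearMap.opNorm_le_bound _ (by positivity) fun u => ?_
      set z := (B s - B t) u with hz
      -- The operator norm is read off from the form by testing `(B s - B t) u` against itself.
      have h1 : ‖z‖ ^ 2 ≤ n * (n * r) * ‖u‖ * ‖z‖ := by
        rw [← real_inner_self_eq_norm_sq]
        nth_rewrite 1 [hz]
        rw [_root_.sub_apply, inner_sub_left, hB s hs, hB t ht, aForm_eq, aForm_eq,
          coeffForm_sub (hC s hs) (hC t ht)]
        exact (le_abs_self _).trans (abs_coeffForm_le hr0 hm u z)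
      have h2 : ‖z‖ ≤ n * (n * r) * ‖u‖ := by
        rcases (norm_nonneg z).eq_or_lt with h0 | h0
        · rw [← h0]; positivity
        · refine le_of_mul_le_mul_right ?_ h0
          rwa [← sq]
      refine h2.trans (le_of_eq ?_)
      rw [hr]; ring
    refine (tendsto_iff_norm_sub_tendsto_zero (E := H1 n →L[ℝ] H1 n)).2 ?_
    refine squeeze_zero' (Eventually.of_forall fun _ => ContinuousLinearMap.opNorm_nonneg _) ?_
      ((tendsto_logLip_modulus t (n * (n * |D|))).mono_left nhdsWithin_le_nhds)
    have hball : ∀ᶠ s in 𝓝[Icc 0 T] t, |s - t| ≤ 1 :=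
      nhdsWithin_le_nhds (Metric.closedBall_mem_nhds t one_pos)
    filter_upwards [hball, self_mem_nhdsWithin] with s h1 h2 using hle s h2 h1
  · rw [hB t ht]
    refine le_trans ?_ (ha.aForm_self ht u).1
    exact mul_nonneg ha.kappa_pos.le (Finset.sum_nonneg fun _ _ => by positivity)
  · rw [hB t ht, fnL_apply, u.norm_sq_eq]
    linarith [(ha.aForm_self ht u).1]

end Sobolev

/-! ### Regularized least squares and the abstract solution operator. -/

section AbstractOperator

variable {V H : Type*} [NormedAddCommGroup V] [InnerProductSpace ℝ V]
  [NormedAddCommGroup H] [InnerProductSpace ℝ H]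
  {i : V →L[ℝ] H} {B : ℝ → V →L[ℝ] V} {T : ℝ}

theorem IsParabolic.mono (hp : IsParabolic i B T) {p : ℝ} (hpT : p ≤ T) : IsParabolic i B p where
  inj := hp.inj
  dense := hp.dense
  cont := hp.cont.mono (Icc_subset_Icc_right hpT)
  nonneg t ht := hp.nonneg t ⟨ht.1, ht.2.trans hpT⟩
  coercive := hp.coercive.imp fun _ h => ⟨h.1, fun t ht => h.2 t ⟨ht.1, ht.2.trans hpT⟩⟩

/-- Cauchy–Schwarz for the semi-inner product `⟪Q u, v⟫`, through the discriminant of `t ↦ ⟪Q (u + t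
v), u + t v⟫`. It keeps the constant `c` of the quadratic form, with no loss for the mixed term. -/
theorem abs_inner_le_of_symm {Q : V →L[ℝ] V} {c : ℝ} (hsymm : ∀ u v, ⟪Q u, v⟫_ℝ = ⟪Q v, u⟫_ℝ)
    (hpos : ∀ v, 0 ≤ ⟪Q v, v⟫_ℝ) (hle : ∀ v, ⟪Q v, v⟫_ℝ ≤ c * ‖v‖ ^ 2) (hc : 0 ≤ c) (u v : V) :
    |⟪Q u, v⟫_ℝ| ≤ c * ‖u‖ * ‖v‖ := by
  have h : ∀ t : ℝ, 0 ≤ ⟪Q v, v⟫_ℝ * (t * t) + 2 * ⟪Q u, v⟫_ℝ * t + ⟪Q u, u⟫_ℝ := fun t => by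
    have := hpos (u + t • v)
    simp only [map_add, map_smul, inner_add_left, inner_add_right, inner_smul_left,
      inner_smul_right, conj_trivial, hsymm v u] at this
    linarith
  have h1 := discrim_le_zero h
  rw [discrim] at h1
  have h2 : ⟪Q u, v⟫_ℝ ^ 2 ≤ (c * ‖u‖ * ‖v‖) ^ 2 := by
    have h3 : ⟪Q v, v⟫_ℝ * ⟪Q u, u⟫_ℝ ≤ (c * ‖v‖ ^ 2) * (c * ‖u‖ ^ 2) :=
      mul_le_mul (hle v) (hle u) (hpos u) (by positivity)
    nlinarith
  exact abs_le_of_sq_le_sq h2 (by positivity)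

/-- Error estimate for the regularized least squares problem. -/
theorem regularization_estimate {Q : V →L[ℝ] V} {A : V →L[ℝ] H} {κ M δ E : ℝ} (hκ : 0 < κ)
    (hM : 0 < M) (hδ : 0 < δ) (hsymm : ∀ u v, ⟪Q u, v⟫_ℝ = ⟪Q v, u⟫_ℝ)
    (hlow : ∀ v, κ * ‖v‖ ^ 2 ≤ ⟪Q v, v⟫_ℝ) (hup : ∀ v, ⟪Q v, v⟫_ℝ ≤ 1 / κ * ‖v‖ ^ 2)
    (hA : ∀ v, ‖A v‖ ≤ M * ‖v‖) {x w : V} (hx : ‖x‖ ≤ E) {g : H} (hg : ‖g - A x‖ ≤ δ)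
    (hw : ∀ h, δ * M * κ * ⟪Q w, h⟫_ℝ + ⟪A w, A h⟫_ℝ = ⟪g, A h⟫_ℝ) :
    ‖w - x‖ ≤ 1 / κ ^ 2 * (1 + E) ∧ ‖A w - A x‖ ≤ √M / κ * (1 + E) * √δ := by
  set d := w - x with hd
  have hE : 0 ≤ E := (norm_nonneg x).trans hx
  have hpos : ∀ v, 0 ≤ ⟪Q v, v⟫_ℝ := fun v => le_trans (by positivity) (hlow v)
  have h1 : δ * M * κ * ⟪Q d, d⟫_ℝ + ‖A d‖ ^ 2 =
      ⟪g - A x, A d⟫_ℝ - δ * M * κ * ⟪Q x, d⟫_ℝ := by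
    have hQd : ∀ y, ⟪Q d, y⟫_ℝ = ⟪Q w, y⟫_ℝ - ⟪Q x, y⟫_ℝ := fun y => by
      rw [hd, map_sub, inner_sub_left]
    have hAd : ∀ y, ⟪A d, y⟫_ℝ = ⟪A w, y⟫_ℝ - ⟪A x, y⟫_ℝ := fun y => by
      rw [hd, map_sub, inner_sub_left]
    rw [← real_inner_self_eq_norm_sq, inner_sub_left, ← hw d, hQd, hAd]
    ring
  have h2 : ⟪g - A x, A d⟫_ℝ ≤ δ * (M * ‖d‖) :=
    (real_inner_le_norm _ _).trans (mul_le_mul hg (hA d) (norm_nonneg _) hδ.le)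
  have h3 : -⟪Q x, d⟫_ℝ ≤ 1 / κ * E * ‖d‖ := by
    refine (neg_le_abs _).trans ((abs_inner_le_of_symm hsymm hpos hup (by positivity) x d).trans ?_)
    gcongr
  have h4 : δ * M * κ * -⟪Q x, d⟫_ℝ ≤ δ * M * κ * (1 / κ * E * ‖d‖) := by gcongr
  -- The factor `κ` in `α = δMκ` cancels the `1/κ` of the upper bound, which matches this term with
  -- the noise term `δM‖d‖`.
  have h5 : δ * M * κ * (1 / κ * E * ‖d‖) = δ * M * E * ‖d‖ := by field_simp
  have h6 : δ * M * κ * (κ * ‖d‖ ^ 2) ≤ δ * M * κ * ⟪Q d, d⟫_ℝ := by gcongr; exact hlow d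
  have h7 : δ * M * κ * (κ * ‖d‖ ^ 2) + ‖A d‖ ^ 2 ≤ δ * M * (1 + E) * ‖d‖ := by linarith
  have h8 : ‖d‖ ≤ 1 / κ ^ 2 * (1 + E) := by
    rw [one_div, ← div_eq_inv_mul, le_div_iff₀ (by positivity)]
    rcases (norm_nonneg d).eq_or_lt with h0 | h0
    · rw [← h0, zero_mul]; positivity
    · refine le_of_mul_le_mul_left ?_ (show 0 < δ * M * ‖d‖ by positivity)
      nlinarith [sq_nonneg ‖A d‖]
  refine ⟨h8, ?_⟩
  rw [← map_sub, ← hd]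
  refine abs_le_of_sq_le_sq' ?_ (by positivity) |>.2
  have h9 : (√M / κ * (1 + E) * √δ) ^ 2 = δ * M * (1 + E) * (1 / κ ^ 2 * (1 + E)) := by
    rw [mul_pow, mul_pow, div_pow, Real.sq_sqrt hM.le, Real.sq_sqrt hδ.le]; ring
  have h10 : 0 ≤ δ * M * κ * (κ * ‖d‖ ^ 2) := by positivity
  rw [h9]
  calc ‖A d‖ ^ 2 ≤ δ * M * (1 + E) * ‖d‖ := by linarith
    _ ≤ _ := by gcongr

variable [CompleteSpace V] [CompleteSpace H]

theorem IsWeakSol.mono {u : ℝ → H} {w : ℝ → V} (hu : IsWeakSol i B T u w) {p : ℝ} (hpT : p ≤ T) :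
    IsWeakSol i B p u w where
  cont := hu.cont.mono (Icc_subset_Icc_right hpT)
  memLp := hu.memLp.mono_measure (Measure.restrict_mono (Icc_subset_Icc_right hpT) le_rfl)
  ae_eq := ae_mono (Measure.restrict_mono (Icc_subset_Icc_right hpT) le_rfl) hu.ae_eq
  eqn t ht := hu.eqn t ⟨ht.1, ht.2.trans hpT⟩

theorem IsWeakSol.congr {u u' : ℝ → H} {w : ℝ → V} (hu : IsWeakSol i B T u w)
    (h : EqOn u' u (Icc 0 T)) : IsWeakSol i B T u' w where
  cont := hu.cont.congr h
  memLp := hu.memLp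
  ae_eq := by
    filter_upwards [hu.ae_eq, ae_restrict_mem measurableSet_Icc] with t h1 h2
    rw [h1, h h2]
  eqn t ht := by rw [h ht, h ⟨le_rfl, ht.1.trans ht.2⟩]; exact hu.eqn t ht

theorem IsWeakSol.add {u u' : ℝ → H} {w w' : ℝ → V} (hB : ContinuousOn B (Icc 0 T))
    (hu : IsWeakSol i B T u w) (hu' : IsWeakSol i B T u' w') :
    IsWeakSol i B T (u + u') (w + w') where
  cont := hu.cont.add hu'.cont
  memLp := hu.memLp.add hu'.memLp
  ae_eq := by
    filter_upwards [hu.ae_eq, hu'.ae_eq] with t h1 h2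
    rw [Pi.add_apply, map_add, h1, h2, Pi.add_apply]
  eqn t ht := by
    have h0 : (0 : ℝ) ∈ Icc 0 T := ⟨le_rfl, ht.1.trans ht.2⟩
    simp only [Pi.add_apply, map_add]
    rw [intervalIntegral.integral_add
      (intervalIntegrable_of_memLp (memLp_clm_apply hB hu.memLp) h0 ht)
      (intervalIntegrable_of_memLp (memLp_clm_apply hB hu'.memLp) h0 ht),
      ← hu.eqn t ht, ← hu'.eqn t ht]
    abel

theorem IsWeakSol.smul {u : ℝ → H} {w : ℝ → V} (c : ℝ) (hu : IsWeakSol i B T u w) :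
    IsWeakSol i B T (c • u) (c • w) where
  cont := hu.cont.const_smul c
  memLp := hu.memLp.const_smul c
  ae_eq := by
    filter_upwards [hu.ae_eq] with t h1
    rw [Pi.smul_apply, map_smul, h1, Pi.smul_apply]
  eqn t ht := by
    simp only [Pi.smul_apply, map_smul]
    rw [intervalIntegral.integral_smul, ← smul_add, hu.eqn t ht]

theorem IsWeakSol.unique (hp : IsParabolic i B T) {u u' : ℝ → H} {w w' : ℝ → V}
    (hu : IsWeakSol i B T u w) (hu' : IsWeakSol i B T u' w') (h0 : u 0 = u' 0) :
    EqOn u u' (Icc 0 T) := by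
  intro t ht
  have h := (hu.add hp.cont (hu'.smul (-1))).eq_zero hp (by simp [h0]) t ht
  simpa [← sub_eq_add_neg, sub_eq_zero] using h

/-- The solution operator of the abstract parabolic problem. -/
theorem IsParabolic.exists_solutionOperator (hp : IsParabolic i B T) (hT : 0 ≤ T) :
    ∃ S : H →L[ℝ] H, ∀ f, ∃ u w, IsWeakSol i B T u w ∧ u 0 = f ∧ u T = S f := by
  obtain ⟨C, hC, hex⟩ := hp.exists_isWeakSol hT
  choose u w hu hu0 hub using hex
  have hTm : T ∈ Icc 0 T := ⟨hT, le_rfl⟩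
  -- The solutions are chosen arbitrarily; uniqueness makes their final values linear in the initial
  -- value.
  let S : H →ₗ[ℝ] H :=
    { toFun := fun f => u f T
      map_add' := fun f g => (hu (f + g)).unique hp ((hu f).add hp.cont (hu g))
        (by simp [hu0]) hTm
      map_smul' := fun c f => (hu (c • f)).unique hp ((hu f).smul c) (by simp [hu0]) hTm }
  refine ⟨S.mkContinuous √C fun f => ?_, fun f => ⟨u f, w f, hu f, hu0 f, rfl⟩⟩
  refine abs_le_of_sq_le_sq' ?_ (by positivity) |>.2
  rw [mul_pow, Real.sq_sqrt hC]
  exact hub f T hTm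

/-- Well-posedness of a coercive variational problem. -/
theorem coercive_wellPosed (S : V →L[ℝ] V) {c : ℝ} (hc : 0 < c)
    (h : ∀ v, c * ‖v‖ ^ 2 ≤ ⟪S v, v⟫_ℝ) (φ : V →L[ℝ] ℝ) :
    (∃! w, ∀ v, ⟪S w, v⟫_ℝ = φ v) ∧ ∀ w, (∀ v, ⟪S w, v⟫_ℝ = φ v) → ‖w‖ ≤ 1 / c * ‖φ‖ := by
  obtain ⟨e, he⟩ := exists_equiv_of_coercive S hc h
  set y := (InnerProductSpace.toDual ℝ V).symm φ with hy
  have hyφ : ∀ v, ⟪y, v⟫_ℝ = φ v := fun v => InnerProductSpace.toDual_symm_apply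
  refine ⟨⟨e.symm y, fun v => ?_, fun w hw => ?_⟩, fun w hw => ?_⟩
  · rw [← he, e.apply_symm_apply, hyφ]
  · rw [ContinuousLinearEquiv.eq_symm_apply, he]
    exact ext_inner_right ℝ fun v => (hw v).trans (hyφ v).symm
  · have h1 : c * ‖w‖ ^ 2 ≤ ‖φ‖ * ‖w‖ :=
      (h w).trans ((hw w).le.trans ((le_abs_self _).trans (φ.le_opNorm w)))
    rw [one_div, ← div_eq_inv_mul, le_div_iff₀ hc]
    rcases (norm_nonneg w).eq_or_lt with h0 | h0
    · rw [← h0, zero_mul]; exact norm_nonneg φ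
    · refine le_of_mul_le_mul_right ?_ h0
      linarith

theorem inner_smul_add_gram (Q : V →L[ℝ] V) (A : V →L[ℝ] H) (c : ℝ) (u v : V) :
    ⟪(c • Q + gram A) u, v⟫_ℝ = c * ⟪Q u, v⟫_ℝ + ⟪A u, A v⟫_ℝ := by
  rw [_root_.add_apply, _root_.smul_apply, inner_add_left, real_inner_smul_left, inner_gram]

/-- Well-posedness of the regularized least squares problem. -/
theorem regularized_wellPosed {Q : V →L[ℝ] V} (A : V →L[ℝ] H) {κ α : ℝ} (hκ : 0 < κ)
    (hα : 0 < α) (hlow : ∀ v, κ * ‖v‖ ^ 2 ≤ ⟪Q v, v⟫_ℝ) (φ : V →L[ℝ] ℝ) :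
    (∃! w, ∀ h, α * ⟪Q w, h⟫_ℝ + ⟪A w, A h⟫_ℝ = φ h) ∧
      ∀ w, (∀ h, α * ⟪Q w, h⟫_ℝ + ⟪A w, A h⟫_ℝ = φ h) → ‖w‖ ≤ 1 / (κ * α) * ‖φ‖ := by
  have h := coercive_wellPosed (α • Q + gram A) (c := κ * α) (by positivity) (fun v => by
    rw [inner_smul_add_gram, real_inner_self_eq_norm_sq]
    have h1 := mul_le_mul_of_nonneg_left (hlow v) hα.le
    have h2 : 0 ≤ ‖A v‖ ^ 2 := by positivity
    linarith) φ
  simpa only [inner_smul_add_gram] using h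

end AbstractOperator

/-! ### The concrete evolution operator and the energy form at time `0`. -/

section Evolution

variable {n : ℕ} {a : ℝ → Rn n → Matrix (Fin n) (Fin n) ℝ} {T κ : ℝ}

/-- Pairing the abstract identity in `H¹` with each `v` gives the tested equation, since a bounded
functional commutes with the Bochner integral. -/
theorem isSolution_iff {B : ℝ → H1 n →L[ℝ] H1 n} {p : ℝ}
    (hB : ∀ t ∈ Icc 0 p, ∀ u v, ⟪B t u, v⟫_ℝ = aForm a t u v)
    (hBc : ContinuousOn B (Icc 0 p)) {u : ℝ → L2 n} :
    IsSolution a 0 p u ↔ ∃ w, IsWeakSol (V := H1 n) (H := L2 n) (fnL n) B p u w := by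
  have key : ∀ w : ℝ → H1 n, MemLp w 2 (volume.restrict (Icc 0 p)) → ∀ t ∈ Icc 0 p, ∀ v : H1 n,
      ⟪u t, v.fn⟫_ℝ + ∫ τ in 0..t, aForm a τ (w τ) v =
        ⟪ContinuousLinearMap.adjoint (𝕜 := ℝ) (E := H1 n) (F := L2 n) (fnL n) (u t) + ∫ τ in 0..t, B τ (w τ), v⟫_ℝ := by
    intro w hw t ht v
    have h0 : (0 : ℝ) ∈ Icc 0 p := ⟨le_rfl, ht.1.trans ht.2⟩
    have hi := intervalIntegrable_of_memLp (memLp_clm_apply (V := H1 n) hBc hw) h0 ht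
    rw [inner_add_left, ContinuousLinearMap.adjoint_inner_left, fnL_apply]
    congr 1
    have e := ((innerSL ℝ (E := H1 n)).flip v).intervalIntegral_comp_comm hi
    refine Eq.trans ?_ e
    refine intervalIntegral.integral_congr fun τ hτ => ?_
    rw [uIcc_of_le ht.1] at hτ
    exact (hB τ ⟨hτ.1, hτ.2.trans ht.2⟩ _ _).symm
  have key0 : ∀ v : H1 n, ⟪u 0, v.fn⟫_ℝ = ⟪ContinuousLinearMap.adjoint (𝕜 := ℝ) (E := H1 n) (F := L2 n) (fnL n) (u 0), v⟫_ℝ :=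
    fun v => by rw [ContinuousLinearMap.adjoint_inner_left, fnL_apply]
  constructor
  · rintro ⟨hc, w, hw, hae, heq⟩
    refine ⟨w, hc, hw, hae, fun t ht => ext_inner_right ℝ fun v => ?_⟩
    rw [← key w hw t ht v, heq v t ht, key0]
  · rintro ⟨w, hw⟩
    refine ⟨hw.cont, w, hw.memLp, hw.ae_eq, fun v t ht => ?_⟩
    rw [key w hw.memLp t ht v, hw.eqn t ht, key0]

theorem IsAdmissible.isSolutionOperator_evol (ha : IsAdmissible a T κ) {p : ℝ}
    (hp : p ∈ Icc 0 T) : IsSolutionOperator a p 0 (evol a p 0) := by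
  obtain ⟨B, hB, hpar⟩ := ha.exists_isParabolic
  have hparp := hpar.mono hp.2
  have hex : ∃ S, IsSolutionOperator a p 0 S := by
    obtain ⟨S, hS⟩ := hparp.exists_solutionOperator hp.1
    refine ⟨S, fun f => ?_⟩
    obtain ⟨u, w, hu, h0, h1⟩ := hS f
    exact ⟨u, (isSolution_iff (fun t ht => hB t ⟨ht.1, ht.2.trans hp.2⟩) hparp.cont).2 ⟨w, hu⟩,
      h0, h1⟩
  rw [evol, dif_pos hex]
  exact hex.choose_spec

/-- Uniqueness on `[0,p]` removes the arbitrary choice in `evol`. -/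
theorem IsAdmissible.evol_eq (ha : IsAdmissible a T κ) {u : ℝ → L2 n} (hu : IsSolution a 0 T u)
    {p : ℝ} (hp : p ∈ Icc 0 T) : evol a p 0 (u 0) = u p := by
  obtain ⟨B, hB, hpar⟩ := ha.exists_isParabolic
  obtain ⟨w, hw⟩ := (isSolution_iff hB hpar.cont).1 hu
  have hparp := hpar.mono hp.2
  obtain ⟨u', hu', h0, h1⟩ := ha.isSolutionOperator_evol hp (u 0)
  obtain ⟨w', hw'⟩ :=
    (isSolution_iff (fun t ht => hB t ⟨ht.1, ht.2.trans hp.2⟩) hparp.cont).1 hu'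
  rw [← h1]
  exact hw'.unique hparp (hw.mono hp.2) h0 ⟨hp.1, le_rfl⟩

/-- The operators `evol a t 0` are chosen separately for each `t`; they fit together because all of
them follow one solution on `[0,T]`. -/
theorem IsAdmissible.isSolution_evol (ha : IsAdmissible a T κ) (hT : 0 ≤ T) (f : L2 n) :
    IsSolution a 0 T (fun t => evol a t 0 f) ∧ evol a 0 0 f = f := by
  obtain ⟨B, hB, hpar⟩ := ha.exists_isParabolic
  obtain ⟨u, hu, rfl, -⟩ := ha.isSolutionOperator_evol ⟨hT, le_rfl⟩ f
  obtain ⟨w, hw⟩ := (isSolution_iff hB hpar.cont).1 hu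
  exact ⟨(isSolution_iff hB hpar.cont).2 ⟨w, hw.congr fun t ht => ha.evol_eq hu ht⟩,
    ha.evol_eq hu ⟨le_rfl, hT⟩⟩

theorem H1.norm_fn_le (u : H1 n) : ‖u.fn‖ ≤ ‖u‖ := by
  refine abs_le_of_sq_le_sq' ?_ (norm_nonneg _) |>.2
  rw [u.norm_sq_eq]
  exact le_add_of_nonneg_right (Finset.sum_nonneg fun _ _ => by positivity)

/-- The operator on `H¹` representing the form `a(0;u,v) + ⟨u,v⟩`. -/
theorem IsAdmissible.exists_energyOperator (ha : IsAdmissible a T κ) (hT : 0 ≤ T) :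
    ∃ Q : H1 n →L[ℝ] H1 n, (∀ u v, ⟪Q u, v⟫_ℝ = aForm a 0 u v + ⟪u.fn, v.fn⟫_ℝ) ∧
      (∀ u v, ⟪Q u, v⟫_ℝ = ⟪Q v, u⟫_ℝ) ∧ (∀ v, κ * ‖v‖ ^ 2 ≤ ⟪Q v, v⟫_ℝ) ∧
      ∀ v, ⟪Q v, v⟫_ℝ ≤ 1 / κ * ‖v‖ ^ 2 := by
  obtain ⟨B, hB, -⟩ := ha.exists_isParabolic
  have hκ := ha.kappa_pos
  have h0m : (0 : ℝ) ∈ Icc 0 T := ⟨le_rfl, hT⟩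
  have hQ : ∀ u v : H1 n, ⟪(B 0 + gram (V := H1 n) (fnL n)) u, v⟫_ℝ =
      aForm a 0 u v + ⟪u.fn, v.fn⟫_ℝ := fun u v => by
    rw [_root_.add_apply, inner_add_left, hB 0 h0m, inner_gram]; rfl
  refine ⟨B 0 + gram (V := H1 n) (fnL n), hQ, fun u v => ?_, fun v => ?_, fun v => ?_⟩
  · rw [hQ, hQ, real_inner_comm, aForm_eq, aForm_eq, coeffForm_swap]
    congr 2
    ext x j k
    exact ha.symm 0 h0m x k j
  · rw [hQ, real_inner_self_eq_norm_sq, v.norm_sq_eq]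
    have h1 := (ha.aForm_self h0m v).1
    -- `κ ≤ 1` lets the zero-order term share the ellipticity constant of the gradient term.
    have h2 : κ * ‖v.fn‖ ^ 2 ≤ 1 * ‖v.fn‖ ^ 2 := by gcongr; exact ha.kappa_le_one
    linarith
  · rw [hQ, real_inner_self_eq_norm_sq, v.norm_sq_eq]
    have h1 := (ha.aForm_self h0m v).2
    have h2 : 1 * ‖v.fn‖ ^ 2 ≤ 1 / κ * ‖v.fn‖ ^ 2 := by
      gcongr; exact (one_le_div hκ).2 ha.kappa_le_one
    linarith

end Evolution

end ParabolicQBV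

/-! ### The regularized backward problem. -/

open ParabolicQBV in
theorem theorem3p3 {n : ℕ} (a : ℝ → Rn n → Matrix (Fin n) (Fin n) ℝ) (T κ : ℝ) (hT : 0 < T)
    (ha : IsAdmissible a T κ)
    (M : ℝ) (hM : 0 < M) (hUM : ‖evol a T 0‖ ≤ M)
    (E : ℝ) (ubar : ℝ → H1 n) (hubar : IsSolution a 0 T (fun t => (ubar t).fn))
    (hE : ‖ubar 0‖ ≤ E)
    (δ : ℝ) (hδ : 0 < δ) (g : L2 n) (hg : ‖g - (ubar T).fn‖ ≤ δ) :
    -- the variational problem with `α = δ M κ` is well posed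
    (∀ φ : H1 n →L[ℝ] ℝ, (∃! w : H1 n, ∀ h : H1 n, bForm a T (δ * M * κ) w h = φ h) ∧
      ∀ w : H1 n, (∀ h : H1 n, bForm a T (δ * M * κ) w h = φ h) →
        ‖w‖ ≤ 1 / (κ * (δ * M * κ)) * ‖φ‖) ∧
    ∃ w : H1 n,
      -- `w` is its unique solution for the right-hand side `U(T,0)^* g`
      (∀ w' : H1 n, (∀ h : H1 n, bForm a T (δ * M * κ) w' h =
        ⟪ContinuousLinearMap.adjoint (evol a T 0) g, h.fn⟫_ℝ) ↔ w' = w) ∧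
      -- `u(t) = U(t,0) w` is a solution with `u(0) = w`
      IsSolution a 0 T (fun t => evol a t 0 w.fn) ∧ evol a 0 0 w.fn = w.fn ∧
      -- the two estimates
      ‖w - ubar 0‖ ≤ 1 / κ ^ 2 * (1 + E) ∧
      ‖evol a T 0 w.fn - (ubar T).fn‖ ≤ √M / κ * (1 + E) * √δ := by
  have hκ := ha.kappa_pos
  obtain ⟨Q, hQ, hsymm, hlow, hup⟩ := ha.exists_energyOperator hT.le
  let A : H1 n →L[ℝ] L2 n := (evol a T 0).comp (fnL n)
  have hb : ∀ u v : H1 n, bForm a T (δ * M * κ) u v =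
      δ * M * κ * ⟪Q u, v⟫_ℝ + ⟪A u, A v⟫_ℝ := fun u v => by rw [hQ, bForm]; rfl
  have hwp := regularized_wellPosed (V := H1 n) A hκ (α := δ * M * κ) (by positivity) hlow
  have hrhs : ∀ h : H1 n, ⟪ContinuousLinearMap.adjoint (evol a T 0) g, h.fn⟫_ℝ = ⟪g, A h⟫_ℝ :=
    fun h => ContinuousLinearMap.adjoint_inner_left _ _ _
  simp only [hb, hrhs]
  refine ⟨hwp, ?_⟩
  -- The right-hand side `⟨U(T,0)^* g, h⟩` is the functional `h ↦ ⟪g, A h⟫`.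
  obtain ⟨w, hw, huniq⟩ := (hwp ((innerSL ℝ g).comp A)).1
  obtain ⟨hsol, hinit⟩ := ha.isSolution_evol hT.le w.fn
  -- Uniqueness makes `ubar T` the image of `ubar 0`, so `g` is a `δ`-perturbation of exact data.
  have hUbar : A (ubar 0) = (ubar T).fn := ha.evol_eq hubar ⟨hT.le, le_rfl⟩
  have hAM : ∀ v : H1 n, ‖A v‖ ≤ M * ‖v‖ := fun v =>
    ((evol a T 0).le_of_opNorm_le hUM _).trans
      (mul_le_mul_of_nonneg_left v.norm_fn_le hM.le)
  obtain ⟨e1, e2⟩ := regularization_estimate (V := H1 n) hκ hM hδ hsymm hlow hup hAM hE (g := g)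
    (by rwa [hUbar]) hw
  rw [hUbar] at e2
  exact ⟨w, fun w' => ⟨huniq w', fun h => h ▸ hw⟩, hsol, hinit, e1, e2⟩
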